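/- Let $G$ be a group. A $G$-tree is a tree on which $G$ acts by automorphisms without inversions; it is cocompact if the quotient graph is finite, and it is a generalized Baumslag--Solitar (GBS) tree if all of its vertex and edge stabilizers are infinite cyclic. A collapse move on a $G$-tree $X$ chooses an edge $e$ with endpoints $a,b$ in different $G$-orbits such that $G_e=G_b$, and collapses every edge in the orbit of $e$ to a vertex, the result being a $G$-tree (taken up to equivariant isomorphism). Equivalently, in the quotient graph of groups an edge carrying an amalgamation $A*_C C$ is collapsed to a vertex with group $A$. An expansion move is the reverse of a collapse move, and a deformation is a finite sequence of collapse and expansion moves. A $G$-tree is fully reduced if no vertex stabilizer contains the stabilizer of a vertex from a different orbit, that is, $G_v\subseteq G_w$ implies $v\in Gw$. **Theorem.** Every cocompact generalized Baumslag--Solitar $G$-tree is related by a deformation to a fully reduced generalized Baumslag--Solitar $G$-tree. -/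

import Mathlib

universe u

/-- A `G`-tree: a tree on which the group `G` acts by automorphisms, without inversions.
(A tree has neither loops nor multiple edges, so it is a simple graph; an oriented edge with
initial vertex `v` and terminal vertex `w` is an adjacent pair `(v, w)`.) -/
structure GTree (G : Type u) [Group G] where
  V : Type u
  action : MulAction G V
  graph : SimpleGraph V
  isTree : graph.IsTree
  adj_smul : ∀ (g : G) (v w : V), graph.Adj v w → graph.Adj (g • v) (g • w)
  no_inversion : ∀ (g : G) (v w : V), graph.Adj v w → ¬ (g • v = w ∧ g • w = v)

namespace GTree

attribute [instance] GTree.action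

variable {G : Type u} [Group G]

/-- The stabilizer of the vertex `v`. -/
def vertexStab (X : GTree G) (v : X.V) : Subgroup G := MulAction.stabilizer G v

/-- The stabilizer of the (oriented) edge from `v` to `w`; since there are no inversions, this is
also the stabilizer of the unoriented edge. -/
def edgeStab (X : GTree G) (v w : X.V) : Subgroup G := X.vertexStab v ⊓ X.vertexStab w

/-- A generalized Baumslag–Solitar tree: all vertex and edge stabilizers are infinite cyclic. -/
def IsGBS (X : GTree G) : Prop :=
  (∀ v : X.V, IsCyclic (X.vertexStab v) ∧ Infinite (X.vertexStab v)) ∧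
  (∀ v w : X.V, X.graph.Adj v w → IsCyclic (X.edgeStab v w) ∧ Infinite (X.edgeStab v w))

/-- The quotient graph is finite: there are finitely many orbits of vertices and finitely many
orbits of oriented edges. -/
def IsCocompact (X : GTree G) : Prop :=
  {o : Set X.V | ∃ v : X.V, o = MulAction.orbit G v}.Finite ∧
  {o : Set (X.V × X.V) | ∃ v w : X.V, X.graph.Adj v w ∧ o = MulAction.orbit G (v, w)}.Finite

/-- No vertex stabilizer contains the stabilizer of a vertex from a different orbit. -/
def IsFullyReduced (X : GTree G) : Prop :=
  ∀ v w : X.V, X.vertexStab v ≤ X.vertexStab w → v ∈ MulAction.orbit G w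

/-- `Y` is (equivariantly isomorphic to) the `G`-tree obtained from `X` by collapsing every edge
in the orbit of the edge `ab` to a point, `φ` being the quotient map on vertices. -/
structure IsQuotientCollapsing (X Y : GTree G) (a b : X.V) (φ : X.V → Y.V) : Prop where
  surjective : Function.Surjective φ
  map_smul : ∀ (g : G) (v : X.V), φ (g • v) = g • φ v
  map_eq_iff : ∀ v w : X.V, φ v = φ w ↔
    Relation.EqvGen (fun x y => ∃ g : G, x = g • a ∧ y = g • b) v w
  adj_iff : ∀ p q : Y.V, Y.graph.Adj p q ↔
    p ≠ q ∧ ∃ v w : X.V, X.graph.Adj v w ∧ φ v = p ∧ φ w = q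

/-- `Y` is obtained from `X` by a collapse move: the orbit of an edge `ab` is collapsed, where
`a` and `b` lie in different orbits (the edge is not a loop in the quotient graph) and the
stabilizer of the edge is equal to the stabilizer of `b` (in the quotient graph of groups the
edge carries an amalgamation `A *_C C`, with `A` and `C` the stabilizers of `a` and `b`). -/
def CollapseMove (X Y : GTree G) : Prop :=
  ∃ a b : X.V, X.graph.Adj a b ∧ b ∉ MulAction.orbit G a ∧
    X.edgeStab a b = X.vertexStab b ∧ ∃ φ : X.V → Y.V, IsQuotientCollapsing X Y a b φ

/-- An expansion move is the reverse of a collapse move. -/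
def ExpansionMove (X Y : GTree G) : Prop := CollapseMove Y X

/-- `X` and `Y` are related by a deformation: a finite sequence of collapse and expansion
moves leading from `X` to `Y`. -/
def Deformation (X Y : GTree G) : Prop :=
  Relation.ReflTransGen (fun Z W => CollapseMove Z W ∨ ExpansionMove Z W) X Y

end GTree

/-! Induct on the number of vertex orbits. If `X` is not fully reduced, some `G_v` fixes a vertex
`w` outside the orbit of `v`. Paths in a tree are unique, so `G_v` fixes the first edge `vx` of the
path to `w`. If `x` lies in another orbit, `vx` collapses and a vertex orbit disappears.

Otherwise `x = t • v`, and as `G_v` is cyclic, `t⁻¹ * h * t = h ^ n` on `G_v`: an ascending loop of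
modulus `n`. Any other edge `vx` can be pulled around this loop and becomes an edge from `v` to `t •
x`, while `G_v` grows to a subgroup `C` of `G_{t • v}` (`exists_isPull`: one expansion, then one
collapse). If `h ^ (n ^ (k + 1))` fixes `x` for all `h` in `G_v`, a suitable `C` lowers the exponent
to `n ^ k`. After finitely many pulls `G_v` itself fixes the far end `x`. Then either `x` is in
another orbit and the edge collapses, or `x = s • v` gives a second ascending loop, of modulus `m`.
One more pull merges the two into a loop of modulus `n * m`.

Termination of the last case: call an edge free if it is a loop at `v` both of whose labels divide a
power of the modulus. Pulling keeps free edges free, and merging makes one more edge orbit free, so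
the number of non-free edge orbits drops. It cannot run out: `w` remains reachable from `v` up to a
power of the modulus, and free loops alone never leave the orbit of `v` (`exists_adj_not_isFree`).
-/

namespace SimpleGraph

/-! ### Trees and cuts -/

variable {V W : Type*} {Γ : SimpleGraph V}

/-- In a tree, every edge separates: there is a set of vertices for which the edge is the only one
leaving it. -/
theorem IsTree.exists_cut (hΓ : Γ.IsTree) {p q : V} (h : Γ.Adj p q) :
    ∃ S : Set V, p ∈ S ∧ q ∉ S ∧
      ∀ p' q', Γ.Adj p' q' → p' ∈ S → q' ∉ S → p' = p ∧ q' = q := by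
  have hb := isBridge_iff.1 (isAcyclic_iff_forall_adj_isBridge.1 hΓ.isAcyclic h)
  refine ⟨{y | (Γ \ fromEdgeSet {s(p, q)}).Reachable p y}, Reachable.refl _, hb, ?_⟩
  intro p' q' h' hp hq
  by_cases hE : s(p', q') = s(p, q)
  · rcases Sym2.eq_iff.1 hE with ⟨rfl, rfl⟩ | ⟨rfl, rfl⟩
    · exact ⟨rfl, rfl⟩
    · exact absurd (Reachable.refl _) hq
  · refine absurd (Reachable.trans hp (Adj.reachable ?_)) hq
    simp only [sdiff_adj, fromEdgeSet_adj, Set.mem_singleton_iff]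
    exact ⟨h', fun h => hE h.1⟩

/-- Once `pq` is deleted no walk can leave `S`, so `pq` is a bridge. Cuts transfer easily along the
quotient maps of collapses and expansions, whereas acyclicity does not. -/
theorem isTree_of_cuts (hc : Γ.Connected)
    (h : ∀ p q, Γ.Adj p q → ∃ S : Set V, p ∈ S ∧ q ∉ S ∧
      ∀ p' q', Γ.Adj p' q' → p' ∈ S → q' ∉ S → p' = p ∧ q' = q) : Γ.IsTree := by
  refine ⟨hc, isAcyclic_iff_forall_adj_isBridge.2 fun p q hpq => isBridge_iff.2 ?_⟩
  obtain ⟨S, hp, hq, hS⟩ := h p q hpq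
  rintro ⟨w⟩
  have key : ∀ {x y : V}, (Γ \ fromEdgeSet {s(p, q)}).Walk x y → x ∈ S → y ∈ S := by
    intro x y w
    induction w with
    | nil => exact id
    | @cons a b c hab _ ih =>
      intro ha
      refine ih (by_contra fun hb => ?_)
      simp only [sdiff_adj, fromEdgeSet_adj, Set.mem_singleton_iff] at hab
      obtain ⟨rfl, rfl⟩ := hS _ _ hab.1 ha hb
      exact hab.2 ⟨rfl, hab.1.ne⟩
  exact hq (key w hp)

/-- The union of the branches at `a` of a tree that start with an edge to a vertex of `N`. -/
theorem IsTree.exists_branches (hΓ : Γ.IsTree) (a : V) (N : Set V) :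
    ∃ B : Set V, a ∉ B ∧ (∀ z, Γ.Adj a z → (z ∈ B ↔ z ∈ N)) ∧
      ∀ y z, Γ.Adj y z → y ≠ a → z ≠ a → y ∈ B → z ∈ B := by
  choose S h1 h2 h3 using fun (z : {z // Γ.Adj a z}) => hΓ.exists_cut z.2.symm
  refine ⟨{y | ∃ z : {z // Γ.Adj a z}, z.1 ∈ N ∧ y ∈ S z}, ?_, ?_, ?_⟩
  · rintro ⟨z, -, hz⟩
    exact h2 z hz
  · intro z hz
    refine ⟨?_, fun h => ⟨⟨z, hz⟩, h, h1 _⟩⟩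
    rintro ⟨z', hN, hz'⟩
    rwa [(h3 z' z a hz.symm hz' (h2 z')).1]
  · rintro y z hyz hy hz ⟨z', hN, hz'⟩
    exact ⟨z', hN, by_contra fun h => hz (h3 z' y z hyz hz' h).2⟩

theorem Connected.of_surjective {Δ : SimpleGraph W} (hΓ : Γ.Connected) (f : V → W)
    (hf : Function.Surjective f) (h : ∀ y z, Γ.Adj y z → Δ.Reachable (f y) (f z)) :
    Δ.Connected := by
  have key : ∀ {x y : V}, Γ.Walk x y → Δ.Reachable (f x) (f y) := by
    intro x y w
    induction w with
    | nil => exact Reachable.refl _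
    | cons hab _ ih => exact (h _ _ hab).trans ih
  have := hΓ.nonempty.map f
  refine ⟨fun p q => ?_⟩
  obtain ⟨y, rfl⟩ := hf p
  obtain ⟨z, rfl⟩ := hf q
  obtain ⟨w⟩ := hΓ.preconnected y z
  exact key w

end SimpleGraph

/-! ### Collapsing an orbit of edges -/

namespace GTree

variable {G : Type u} [Group G]

theorem mem_vertexStab {X : GTree G} {v : X.V} {g : G} : g ∈ X.vertexStab v ↔ g • v = v :=
  MulAction.mem_stabilizer_iff

theorem mem_vertexStab_smul {X : GTree G} {v : X.V} {s g : G} :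
    g ∈ X.vertexStab (s • v) ↔ s⁻¹ * g * s ∈ X.vertexStab v := by
  simp only [mem_vertexStab, mul_smul, inv_smul_eq_iff]

/-- The datum of a collapse: an edge `ab` with `a`, `b` in different orbits and with the stabilizer
of `b` contained in that of `a`. -/
structure CollapseDatum (X : GTree G) where
  a : X.V
  b : X.V
  adj : X.graph.Adj a b
  notMem : b ∉ MulAction.orbit G a
  stab_le : X.vertexStab b ≤ X.vertexStab a

namespace CollapseDatum

variable {X : GTree G} (D : X.CollapseDatum)

/-- The vertices of the collapsed tree: those outside of the orbit of `b`. -/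
abbrev Vertex : Type u := {y : X.V // y ∉ MulAction.orbit G D.b}

theorem a_notMem (g : G) : g • D.a ∉ MulAction.orbit G D.b := by
  rintro ⟨k, hk⟩
  refine D.notMem ⟨k⁻¹ * g, ?_⟩
  simp only at hk ⊢
  rw [mul_smul, ← hk, inv_smul_smul]

theorem smul_notMem (g : G) {y : X.V} (hy : y ∉ MulAction.orbit G D.b) :
    g • y ∉ MulAction.orbit G D.b := by
  rintro ⟨k, hk⟩
  refine hy ⟨g⁻¹ * k, ?_⟩
  simp only at hk ⊢
  rw [mul_smul, hk, inv_smul_smul]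

instance : MulAction G D.Vertex where
  smul g y := ⟨g • y.1, D.smul_notMem g y.2⟩
  one_smul y := Subtype.ext (one_smul G y.1)
  mul_smul g h y := Subtype.ext (mul_smul g h y.1)

theorem val_smul (g : G) (y : D.Vertex) : (g • y).1 = g • y.1 := rfl

open Classical in
/-- The quotient map of a collapse. -/
noncomputable def proj (y : X.V) : D.Vertex :=
  if h : ∃ g : G, g • D.b = y then ⟨h.choose • D.a, D.a_notMem _⟩ else ⟨y, h⟩

theorem proj_val (y : D.Vertex) : D.proj y.1 = y := dif_neg y.2

theorem val_proj {y : X.V} (h : y ∉ MulAction.orbit G D.b) : (D.proj y).1 = y := by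
  rw [proj, dif_neg (show ¬ ∃ g : G, g • D.b = y from h)]

/-- The choice made in `proj` is harmless: two candidates differ by an element of `G_b`, which fixes
`a`. -/
theorem val_proj_b (g : G) : (D.proj (g • D.b)).1 = g • D.a := by
  have h : ∃ k : G, k • D.b = g • D.b := ⟨g, rfl⟩
  rw [proj, dif_pos h]
  have h1 : h.choose • D.b = g • D.b := h.choose_spec
  have h2 : g⁻¹ * h.choose ∈ X.vertexStab D.a := D.stab_le (by
    rw [mem_vertexStab, mul_smul, h1, inv_smul_smul])
  rwa [mem_vertexStab, mul_smul, inv_smul_eq_iff] at h2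

theorem val_proj_a (g : G) : (D.proj (g • D.a)).1 = g • D.a := D.val_proj (D.a_notMem g)

theorem proj_smul (g : G) (y : X.V) : D.proj (g • y) = g • D.proj y := by
  refine Subtype.ext ?_
  by_cases h : y ∈ MulAction.orbit G D.b
  · obtain ⟨k, rfl⟩ := h
    simp only [val_smul, smul_smul, val_proj_b]
  · rw [val_smul, val_proj _ h, val_proj]
    exact D.smul_notMem g h

theorem proj_surjective : Function.Surjective D.proj := fun y => ⟨y.1, D.proj_val y⟩

/-- The graph obtained by a collapse. -/
def quotientGraph : SimpleGraph D.Vertex where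
  Adj p q := p ≠ q ∧ ∃ v w, X.graph.Adj v w ∧ D.proj v = p ∧ D.proj w = q
  symm := ⟨fun _ _ ⟨h, v, w, hvw, hv, hw⟩ => ⟨h.symm, w, v, hvw.symm, hw, hv⟩⟩
  loopless := ⟨fun _ h => h.1 rfl⟩

theorem val_proj_cases (y : X.V) :
    (D.proj y).1 = y ∨ ∃ g : G, y = g • D.b ∧ (D.proj y).1 = g • D.a := by
  by_cases h : y ∈ MulAction.orbit G D.b
  · obtain ⟨g, rfl⟩ := h
    exact Or.inr ⟨g, rfl, D.val_proj_b g⟩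
  · exact Or.inl (D.val_proj h)

theorem proj_a_eq_proj_b (g : G) : D.proj (g • D.a) = D.proj (g • D.b) :=
  Subtype.ext (by rw [val_proj_a, val_proj_b])

/-- The only edge leaving `S` is not collapsed, so the two ends of a collapsed edge lie on the same
side. Hence the cut descends to the quotient. -/
theorem val_proj_mem_iff {y z : X.V} (hyz : D.proj y ≠ D.proj z) {S : Set X.V}
    (hS : ∀ p q, X.graph.Adj p q → p ∈ S → q ∉ S → p = y ∧ q = z) (x : X.V) :
    (D.proj x).1 ∈ S ↔ x ∈ S := by
  rcases D.val_proj_cases x with h | ⟨g, rfl, h⟩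
  · rw [h]
  · rw [h]
    have hadj := X.adj_smul g _ _ D.adj
    constructor
    · intro ha
      by_contra hb
      obtain ⟨h1, h2⟩ := hS _ _ hadj ha hb
      exact hyz (by rw [← h1, ← h2, proj_a_eq_proj_b])
    · intro hb
      by_contra ha
      obtain ⟨h1, h2⟩ := hS _ _ hadj.symm hb ha
      exact hyz (by rw [← h1, ← h2, proj_a_eq_proj_b])

theorem isTree_quotientGraph : D.quotientGraph.IsTree := by
  refine SimpleGraph.isTree_of_cuts
    (X.isTree.connected.of_surjective D.proj D.proj_surjective fun y z h => ?_) ?_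
  · by_cases hyz : D.proj y = D.proj z
    · rw [hyz]
    · exact SimpleGraph.Adj.reachable ⟨hyz, y, z, h, rfl, rfl⟩
  · rintro p q ⟨hpq, y, z, hyz, rfl, rfl⟩
    obtain ⟨S, hy, hz, hS⟩ := X.isTree.exists_cut hyz
    have key := D.val_proj_mem_iff hpq hS
    refine ⟨{p | p.1 ∈ S}, (key y).2 hy, fun h => hz ((key z).1 h), ?_⟩
    rintro _ _ ⟨-, y', z', h', rfl, rfl⟩ h1 h2
    obtain ⟨rfl, rfl⟩ := hS _ _ h' ((key y').1 h1) (fun h => h2 ((key z').2 h))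
    exact ⟨rfl, rfl⟩

/-- The tree obtained by a collapse. -/
def quotient : GTree G where
  V := D.Vertex
  action := inferInstance
  graph := D.quotientGraph
  isTree := D.isTree_quotientGraph
  adj_smul := by
    rintro g _ _ ⟨h, v, w, hvw, rfl, rfl⟩
    exact ⟨fun h' => h (smul_left_cancel g h'), g • v, g • w, X.adj_smul g _ _ hvw,
      D.proj_smul g v, D.proj_smul g w⟩
  no_inversion := by
    rintro g _ _ ⟨h, y, z, hyz, rfl, rfl⟩ ⟨h1, h2⟩
    obtain ⟨S, hy, hz, hS⟩ := X.isTree.exists_cut hyz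
    have key := D.val_proj_mem_iff h hS
    rw [← proj_smul] at h1 h2
    -- An inversion downstairs carries `zy` to an edge leaving `S`, necessarily `yz`; so `g` already
    -- inverts `yz`.
    obtain ⟨h3, h4⟩ := hS _ _ (X.adj_smul g _ _ hyz.symm) ((key _).1 (by rwa [h2, key]))
      (fun h => hz ((key z).1 (by rwa [← h1, key])))
    exact X.no_inversion g y z hyz ⟨h4, h3⟩

theorem isQuotientCollapsing : IsQuotientCollapsing X D.quotient D.a D.b D.proj where
  surjective := D.proj_surjective
  map_smul := D.proj_smul
  map_eq_iff v w := by
    have key : ∀ x : X.V, Relation.EqvGen (fun x y => ∃ g : G, x = g • D.a ∧ y = g • D.b)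
        (D.proj x).1 x := by
      intro x
      rcases D.val_proj_cases x with h | ⟨g, rfl, h⟩
      · rw [h]
        exact .refl _
      · rw [h]
        exact .rel _ _ ⟨g, rfl, rfl⟩
    constructor
    · intro h
      have hv := key v
      rw [h] at hv
      exact (hv.symm _ _).trans _ _ _ (key w)
    · intro h
      induction h with
      | rel x y h =>
        obtain ⟨g, rfl, rfl⟩ := h
        exact D.proj_a_eq_proj_b g
      | refl => rfl
      | symm _ _ _ ih => exact ih.symm
      | trans _ _ _ _ _ ih1 ih2 => exact ih1.trans ih2
  adj_iff _ _ := Iff.rfl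

theorem collapseMove : CollapseMove X D.quotient :=
  ⟨D.a, D.b, D.adj, D.notMem, inf_eq_right.2 D.stab_le, D.proj, D.isQuotientCollapsing⟩

theorem vertexStab_quotient (p : D.quotient.V) :
    D.quotient.vertexStab p = X.vertexStab (Subtype.val p) := by
  ext g
  rw [mem_vertexStab, mem_vertexStab]
  exact Subtype.ext_iff

end CollapseDatum

theorem vertexStab_le_of_equivariant {X Y : GTree G} {φ : X.V → Y.V}
    (hφ : ∀ (g : G) (v : X.V), φ (g • v) = g • φ v) (y : X.V) :
    X.vertexStab y ≤ Y.vertexStab (φ y) := by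
  intro g hg
  rw [mem_vertexStab] at hg ⊢
  rw [← hφ, hg]

/-! ### Expanding a vertex -/

/-- The datum of an expansion at a vertex `a`: a subgroup `C` of its stabilizer, and a set of
neighbours of `a`, the edges to which are to be pulled off `a`. -/
structure ExpansionDatum (X : GTree G) where
  a : X.V
  C : Subgroup G
  N : Set X.V
  le_stab : C ≤ X.vertexStab a
  adj : ∀ z ∈ N, X.graph.Adj a z
  smul_mem : ∀ c ∈ C, ∀ z ∈ N, c • z ∈ N
  mem_of_smul_mem : ∀ g ∈ X.vertexStab a, ∀ z ∈ N, g • z ∈ N → g ∈ C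

namespace ExpansionDatum

variable {X : GTree G} (D : X.ExpansionDatum)

/-- The vertices of the expanded tree. -/
abbrev Vertex : Type u := X.V ⊕ (G ⧸ D.C)

/-- The projection of the expanded tree onto the original one, on vertices. -/
def proj : D.Vertex → X.V :=
  Sum.elim id fun q => Quotient.liftOn' q (fun g => g • D.a) fun g h hgh => by
    have := D.le_stab (QuotientGroup.leftRel_apply.1 hgh)
    rw [mem_vertexStab, mul_smul, inv_smul_eq_iff] at this
    exact this.symm

theorem proj_smul (g : G) (P : D.Vertex) : D.proj (g • P) = g • D.proj P := by
  rcases P with y | q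
  · rfl
  · induction q using QuotientGroup.induction_on with
    | H k => exact mul_smul g k D.a

/-- The edge from `y` to `z` is pulled onto the new vertex `g C`. -/
def Pulled (g : G) (y z : X.V) : Prop := g • D.a = y ∧ g⁻¹ • z ∈ D.N

theorem Pulled.smul {D : X.ExpansionDatum} {g : G} {y z : X.V} (h : D.Pulled g y z) (k : G) :
    D.Pulled (k * g) (k • y) (k • z) :=
  ⟨by rw [mul_smul, h.1], by rw [mul_inv_rev, mul_smul, inv_smul_smul]; exact h.2⟩

/-- By `mem_of_smul_mem`, translates of `N` by different cosets of `C` in `G_a` are disjoint, so an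
edge end is pulled onto at most one new vertex. -/
theorem Pulled.coe_eq {D : X.ExpansionDatum} {g g' : G} {y z : X.V} (h : D.Pulled g y z)
    (h' : D.Pulled g' y z) : (g : G ⧸ D.C) = g' := by
  rw [QuotientGroup.eq]
  have h1 : g⁻¹ * g' ∈ X.vertexStab D.a := by
    rw [mem_vertexStab, mul_smul, h'.1, inv_smul_eq_iff, h.1]
  refine D.mem_of_smul_mem _ h1 _ h'.2 ?_
  rw [smul_smul, mul_assoc, mul_inv_cancel, mul_one]
  exact h.2

theorem Pulled.congr {D : X.ExpansionDatum} {g g' : G} {y z : X.V} (h : D.Pulled g y z)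
    (h' : (g : G ⧸ D.C) = g') : D.Pulled g' y z := by
  rw [QuotientGroup.eq] at h'
  have h1 := D.le_stab h'
  rw [mem_vertexStab, mul_smul, inv_smul_eq_iff] at h1
  refine ⟨by rw [h1, h.1], ?_⟩
  have h2 := D.smul_mem _ (D.C.inv_mem h') _ h.2
  rwa [smul_smul, mul_inv_rev, inv_inv, mul_assoc, mul_inv_cancel, mul_one] at h2

/-- `P` is the initial vertex of the edge of the expanded tree corresponding to the edge from `y`
to `z`. -/
def Att (P : D.Vertex) (y z : X.V) : Prop :=
  (P = Sum.inl y ∧ ∀ g, ¬ D.Pulled g y z) ∨ ∃ g : G, P = Sum.inr (g : G ⧸ D.C) ∧ D.Pulled g y z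

theorem exists_att (y z : X.V) : ∃ P, D.Att P y z := by
  by_cases h : ∃ g, D.Pulled g y z
  · obtain ⟨g, hg⟩ := h
    exact ⟨_, Or.inr ⟨g, rfl, hg⟩⟩
  · exact ⟨_, Or.inl ⟨rfl, not_exists.1 h⟩⟩

variable {D}

theorem Att.proj_eq {P : D.Vertex} {y z : X.V} (h : D.Att P y z) : D.proj P = y := by
  rcases h with ⟨rfl, -⟩ | ⟨g, rfl, hg⟩
  · rfl
  · exact hg.1

theorem Att.unique {P Q : D.Vertex} {y z : X.V} (h : D.Att P y z) (h' : D.Att Q y z) : P = Q := by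
  rcases h with ⟨rfl, h1⟩ | ⟨g, rfl, h1⟩ <;> rcases h' with ⟨rfl, h2⟩ | ⟨g', rfl, h2⟩
  · rfl
  · exact absurd h2 (h1 g')
  · exact absurd h1 (h2 g)
  · rw [h1.coe_eq h2]

theorem Att.smul {P : D.Vertex} {y z : X.V} (h : D.Att P y z) (k : G) :
    D.Att (k • P) (k • y) (k • z) := by
  rcases h with ⟨rfl, h1⟩ | ⟨g, rfl, h1⟩
  · refine Or.inl ⟨rfl, fun g hg => h1 (k⁻¹ * g) ?_⟩
    simpa using hg.smul k⁻¹
  · exact Or.inr ⟨k * g, rfl, h1.smul k⟩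

variable (D)

/-- The graph obtained by an expansion. -/
def expandedGraph : SimpleGraph D.Vertex where
  Adj P Q := (∃ y z, X.graph.Adj y z ∧ D.Att P y z ∧ D.Att Q z y) ∨
    (∃ g : G, P = Sum.inl (g • D.a) ∧ Q = Sum.inr (g : G ⧸ D.C)) ∨
    ∃ g : G, Q = Sum.inl (g • D.a) ∧ P = Sum.inr (g : G ⧸ D.C)
  symm := ⟨by
    rintro P Q (⟨y, z, h, hP, hQ⟩ | h | h)
    · exact Or.inl ⟨z, y, h.symm, hQ, hP⟩
    · exact Or.inr (Or.inr h)
    · exact Or.inr (Or.inl h)⟩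
  loopless := ⟨by
    rintro P (⟨y, z, h, hP, hQ⟩ | ⟨g, rfl, h⟩ | ⟨g, rfl, h⟩)
    · exact h.ne (hP.proj_eq.symm.trans hQ.proj_eq)
    · cases h
    · cases h⟩

theorem proj_eq_or_adj {P Q : D.Vertex} (h : D.expandedGraph.Adj P Q) :
    D.proj P = D.proj Q ∨ X.graph.Adj (D.proj P) (D.proj Q) := by
  rcases h with ⟨y, z, h, hP, hQ⟩ | ⟨g, rfl, rfl⟩ | ⟨g, rfl, rfl⟩
  · rw [hP.proj_eq, hQ.proj_eq]
    exact Or.inr h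
  · exact Or.inl rfl
  · exact Or.inl rfl

theorem reachable_inl_proj (P : D.Vertex) :
    D.expandedGraph.Reachable (Sum.inl (D.proj P)) P := by
  rcases P with y | q
  · exact SimpleGraph.Reachable.refl _
  · induction q using QuotientGroup.induction_on with
    | H k => exact SimpleGraph.Adj.reachable (Or.inr (Or.inl ⟨k, rfl, rfl⟩))

theorem connected_expandedGraph : D.expandedGraph.Connected := by
  have key : ∀ {x y : X.V}, X.graph.Walk x y →
      D.expandedGraph.Reachable (Sum.inl x) (Sum.inl y) := by
    intro x y w
    induction w with
    | nil => exact SimpleGraph.Reachable.refl _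
    | @cons a b c hab _ ih =>
      obtain ⟨P, hP⟩ := D.exists_att a b
      obtain ⟨Q, hQ⟩ := D.exists_att b a
      have h1 := D.reachable_inl_proj P
      have h2 := D.reachable_inl_proj Q
      rw [hP.proj_eq] at h1
      rw [hQ.proj_eq] at h2
      exact h1.trans ((SimpleGraph.Adj.reachable (Or.inl ⟨a, b, hab, hP, hQ⟩)).trans
        (h2.symm.trans ih))
  have : Nonempty D.Vertex := ⟨Sum.inl D.a⟩
  refine ⟨fun P Q => ?_⟩
  obtain ⟨w⟩ := X.isTree.connected.preconnected (D.proj P) (D.proj Q)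
  exact (D.reachable_inl_proj P).symm.trans ((key w).trans (D.reachable_inl_proj Q))

/-- The preimage of a cut works, because the new edges are contracted by `proj`. -/
theorem exists_cut_att {P Q : D.Vertex} {y z : X.V} (h : X.graph.Adj y z) (hP : D.Att P y z)
    (hQ : D.Att Q z y) : ∃ S : Set D.Vertex, P ∈ S ∧ Q ∉ S ∧
      ∀ P' Q', D.expandedGraph.Adj P' Q' → P' ∈ S → Q' ∉ S → P' = P ∧ Q' = Q := by
  obtain ⟨S, hy, hz, hS⟩ := X.isTree.exists_cut h
  refine ⟨D.proj ⁻¹' S, by rwa [Set.mem_preimage, hP.proj_eq],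
    by rwa [Set.mem_preimage, hQ.proj_eq], ?_⟩
  rintro P' Q' (⟨y', z', h', hP', hQ'⟩ | ⟨g, rfl, rfl⟩ | ⟨g, rfl, rfl⟩) h1 h2
  · rw [Set.mem_preimage, hP'.proj_eq] at h1
    rw [Set.mem_preimage, hQ'.proj_eq] at h2
    obtain ⟨rfl, rfl⟩ := hS _ _ h' h1 h2
    exact ⟨hP'.unique hP, hQ'.unique hQ⟩
  · exact absurd h1 h2
  · exact absurd h1 h2

/-- The far side of a new edge consists of the new vertex and everything over the branches at `g •
a` that start with an edge pulled onto it. The conclusion is symmetric in `P` and `Q` so that it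
serves both orientations. -/
theorem exists_cut_new (g : G) : ∃ S : Set D.Vertex, Sum.inr (g : G ⧸ D.C) ∈ S ∧
    Sum.inl (g • D.a) ∉ S ∧ ∀ P Q, D.expandedGraph.Adj P Q →
      (P ∈ S ↔ Q ∈ S) ∨ P = Sum.inr (g : G ⧸ D.C) ∧ Q = Sum.inl (g • D.a) ∨
        Q = Sum.inr (g : G ⧸ D.C) ∧ P = Sum.inl (g • D.a) := by
  obtain ⟨B, ha, hN, hB⟩ := X.isTree.exists_branches (g • D.a) {z | D.Pulled g (g • D.a) z}
  refine ⟨{P | P = Sum.inr (g : G ⧸ D.C) ∨ D.proj P ∈ B}, Or.inl rfl, ?_, ?_⟩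
  · rintro (h | h)
    · cases h
    · exact ha h
  -- the two ends of an edge at `g • a` lie on the same side
  have h1 : ∀ (z : X.V) (P Q : D.Vertex), X.graph.Adj (g • D.a) z → D.Att P (g • D.a) z →
      D.Att Q z (g • D.a) → ((P = Sum.inr (g : G ⧸ D.C) ∨ D.proj P ∈ B) ↔
        (Q = Sum.inr (g : G ⧸ D.C) ∨ D.proj Q ∈ B)) := by
    intro z P Q hz hP hQ
    have hQ' : Q ≠ Sum.inr (g : G ⧸ D.C) := by
      rintro rfl
      exact hz.ne hQ.proj_eq
    rw [hP.proj_eq, hQ.proj_eq, hN z hz, or_iff_left ha, or_iff_right hQ']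
    constructor
    · rintro rfl
      rcases hP with ⟨h, -⟩ | ⟨k, h, hk⟩
      · cases h
      · exact hk.congr (Sum.inr_injective h).symm
    · intro h
      exact hP.unique (Or.inr ⟨g, rfl, h⟩)
  have h2 : ∀ k : G, (Sum.inr (k : G ⧸ D.C) : D.Vertex) ≠ Sum.inr (g : G ⧸ D.C) →
      (((Sum.inl (k • D.a) : D.Vertex) = Sum.inr (g : G ⧸ D.C) ∨ k • D.a ∈ B) ↔
        ((Sum.inr (k : G ⧸ D.C) : D.Vertex) = Sum.inr (g : G ⧸ D.C) ∨ k • D.a ∈ B)) := by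
    intro k hk
    rw [or_iff_right hk, or_iff_right Sum.inl_ne_inr]
  have h3 : ∀ k : G, (Sum.inr (k : G ⧸ D.C) : D.Vertex) = Sum.inr (g : G ⧸ D.C) →
      k • D.a = g • D.a := fun k hk => congrArg D.proj hk
  rintro P Q (⟨y, z, h, hP, hQ⟩ | ⟨k, rfl, rfl⟩ | ⟨k, rfl, rfl⟩)
  · left
    by_cases hy : y = g • D.a
    · subst hy
      exact h1 z P Q h hP hQ
    by_cases hz : z = g • D.a
    · subst hz
      exact (h1 y Q P h.symm hQ hP).symm
    have hP' : P ≠ Sum.inr (g : G ⧸ D.C) := by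
      rintro rfl
      exact hy hP.proj_eq.symm
    have hQ' : Q ≠ Sum.inr (g : G ⧸ D.C) := by
      rintro rfl
      exact hz hQ.proj_eq.symm
    change (P = _ ∨ _) ↔ (Q = _ ∨ _)
    rw [hP.proj_eq, hQ.proj_eq, or_iff_right hP', or_iff_right hQ']
    exact ⟨hB y z h hy hz, hB z y h.symm hz hy⟩
  · by_cases hk : (Sum.inr (k : G ⧸ D.C) : D.Vertex) = Sum.inr (g : G ⧸ D.C)
    · exact Or.inr (Or.inr ⟨hk, by rw [h3 k hk]⟩)
    · exact Or.inl (h2 k hk)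
  · by_cases hk : (Sum.inr (k : G ⧸ D.C) : D.Vertex) = Sum.inr (g : G ⧸ D.C)
    · exact Or.inr (Or.inl ⟨hk, by rw [h3 k hk]⟩)
    · exact Or.inl (h2 k hk).symm

theorem isTree_expandedGraph : D.expandedGraph.IsTree := by
  refine SimpleGraph.isTree_of_cuts D.connected_expandedGraph ?_
  rintro P Q (⟨y, z, h, hP, hQ⟩ | ⟨g, rfl, rfl⟩ | ⟨g, rfl, rfl⟩)
  · exact D.exists_cut_att h hP hQ
  · obtain ⟨S, h1, h2, h3⟩ := D.exists_cut_new g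
    refine ⟨Sᶜ, h2, fun h => h h1, fun P Q h hP hQ => ?_⟩
    rcases h3 P Q h with h | ⟨rfl, rfl⟩ | h
    · exact absurd (h.2 (not_not.1 hQ)) hP
    · exact absurd h1 hP
    · exact h.symm
  · obtain ⟨S, h1, h2, h3⟩ := D.exists_cut_new g
    refine ⟨S, h1, h2, fun P Q h hP hQ => ?_⟩
    rcases h3 P Q h with h | h | ⟨rfl, rfl⟩
    · exact absurd (h.1 hP) hQ
    · exact h
    · exact absurd h1 hQ

/-- The tree obtained by an expansion. -/
def expanded : GTree G where
  V := D.Vertex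
  action := inferInstance
  graph := D.expandedGraph
  isTree := D.isTree_expandedGraph
  adj_smul := by
    rintro k P Q (⟨y, z, h, hP, hQ⟩ | ⟨g, rfl, rfl⟩ | ⟨g, rfl, rfl⟩)
    · exact Or.inl ⟨_, _, X.adj_smul k _ _ h, hP.smul k, hQ.smul k⟩
    · exact Or.inr (Or.inl ⟨k * g, by rw [mul_smul]; rfl, rfl⟩)
    · exact Or.inr (Or.inr ⟨k * g, by rw [mul_smul]; rfl, rfl⟩)
  no_inversion := by
    rintro k P Q (⟨y, z, h, hP, hQ⟩ | ⟨g, rfl, rfl⟩ | ⟨g, rfl, rfl⟩) ⟨h1, h2⟩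
    · have h1' := congrArg D.proj h1
      have h2' := congrArg D.proj h2
      rw [proj_smul, hP.proj_eq, hQ.proj_eq] at h1' h2'
      exact X.no_inversion k y z h ⟨h1', h2'⟩
    · cases h1
    · cases h1

theorem isQuotientCollapsing : IsQuotientCollapsing D.expanded X
    (Sum.inl D.a : D.Vertex) (Sum.inr ((1 : G) : G ⧸ D.C) : D.Vertex) D.proj where
  surjective y := ⟨Sum.inl y, rfl⟩
  map_smul := D.proj_smul
  map_eq_iff P Q := by
    have key : ∀ P : D.Vertex, Relation.EqvGen (fun x y => ∃ g : G,
        x = g • (Sum.inl D.a : D.Vertex) ∧ y = g • (Sum.inr ((1 : G) : G ⧸ D.C) : D.Vertex))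
        (Sum.inl (D.proj P)) P := by
      rintro (y | q)
      · exact .refl _
      · induction q using QuotientGroup.induction_on with
        | H k => exact .rel _ _ ⟨k, rfl, congrArg Sum.inr (congrArg _ (mul_one k).symm)⟩
    constructor
    · intro h
      have hP := key P
      rw [h] at hP
      exact (hP.symm _ _).trans _ _ _ (key Q)
    · intro h
      induction h with
      | rel x y h =>
        obtain ⟨g, rfl, rfl⟩ := h
        exact (D.proj_smul g (Sum.inl D.a)).trans
          ((congrArg (g • ·) (one_smul G D.a).symm).trans
            (D.proj_smul g (Sum.inr ((1 : G) : G ⧸ D.C))).symm)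
      | refl => rfl
      | symm _ _ _ ih => exact ih.symm
      | trans _ _ _ _ _ ih1 ih2 => exact ih1.trans ih2
  adj_iff y z := by
    constructor
    · intro h
      obtain ⟨P, hP⟩ := D.exists_att y z
      obtain ⟨Q, hQ⟩ := D.exists_att z y
      exact ⟨h.ne, P, Q, Or.inl ⟨y, z, h, hP, hQ⟩, hP.proj_eq, hQ.proj_eq⟩
    · rintro ⟨hne, P, Q, h, rfl, rfl⟩
      exact (D.proj_eq_or_adj h).resolve_left hne

/-- The vertices of the original tree, as vertices of the expanded tree. -/
def old (y : X.V) : D.expanded.V := (Sum.inl y : D.Vertex)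

/-- The new vertices of the expanded tree. -/
def new (g : G) : D.expanded.V := (Sum.inr (g : G ⧸ D.C) : D.Vertex)

theorem smul_old (g : G) (y : X.V) : g • D.old y = D.old (g • y) := rfl

theorem smul_new (g k : G) : g • D.new k = D.new (g * k) := rfl

theorem old_injective : Function.Injective D.old := Sum.inl_injective

theorem old_ne_new (y : X.V) (g : G) : D.old y ≠ D.new g := Sum.inl_ne_inr

theorem new_eq_new_iff {g k : G} : D.new g = D.new k ↔ g⁻¹ * k ∈ D.C :=
  Sum.inr_injective.eq_iff.trans QuotientGroup.eq

theorem exists_old_or_new (P : D.expanded.V) : (∃ y, P = D.old y) ∨ ∃ g, P = D.new g := by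
  rcases P with y | q
  · exact Or.inl ⟨y, rfl⟩
  · induction q using QuotientGroup.induction_on with
    | H k => exact Or.inr ⟨k, rfl⟩

theorem vertexStab_old (y : X.V) : D.expanded.vertexStab (D.old y) = X.vertexStab y := by
  ext g
  rw [mem_vertexStab, mem_vertexStab, smul_old, D.old_injective.eq_iff]

theorem vertexStab_new_one : D.expanded.vertexStab (D.new 1) = D.C := by
  ext g
  rw [mem_vertexStab, smul_new, eq_comm, new_eq_new_iff, inv_one, one_mul, mul_one]

theorem adj_new_old (g : G) : D.expanded.graph.Adj (D.new g) (D.old (g • D.a)) :=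
  Or.inr (Or.inr ⟨g, rfl, rfl⟩)

theorem adj_new_of_pulled {g : G} {z : X.V} (h : D.Pulled g (g • D.a) z)
    (hz : ∀ k, ¬ D.Pulled k z (g • D.a)) : D.expanded.graph.Adj (D.new g) (D.old z) := by
  refine Or.inl ⟨g • D.a, z, ?_, Or.inr ⟨g, rfl, h⟩, Or.inl ⟨rfl, hz⟩⟩
  simpa using X.adj_smul g _ _ (D.adj _ h.2)

theorem adj_cases {P Q : D.expanded.V} (h : D.expanded.graph.Adj P Q) :
    (∃ y z, X.graph.Adj y z ∧ D.Att P y z ∧ D.Att Q z y) ∨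
    (∃ g : G, P = D.old (g • D.a) ∧ Q = D.new g) ∨
    ∃ g : G, Q = D.old (g • D.a) ∧ P = D.new g := h

theorem expansionMove : ExpansionMove X D.expanded := by
  refine ⟨D.old D.a, D.new 1, ?_, ?_, ?_, D.proj, D.isQuotientCollapsing⟩
  · simpa using (D.adj_new_old 1).symm
  · rintro ⟨g, h⟩
    exact D.old_ne_new _ _ h
  · change D.expanded.vertexStab _ ⊓ D.expanded.vertexStab _ = _
    rw [vertexStab_old, vertexStab_new_one]
    exact inf_eq_right.2 D.le_stab

end ExpansionDatum
-- Pulling an edge around a loop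
theorem Deformation.trans {X Y Z : GTree G} (h : Deformation X Y) (h' : Deformation Y Z) :
    Deformation X Z := Relation.ReflTransGen.trans h h'

theorem CollapseMove.deformation {X Y : GTree G} (h : CollapseMove X Y) : Deformation X Y :=
  Relation.ReflTransGen.single (Or.inl h)

theorem ExpansionMove.deformation {X Y : GTree G} (h : ExpansionMove X Y) : Deformation X Y :=
  Relation.ReflTransGen.single (Or.inr h)

/-- `Y` is obtained from `X` by enlarging the stabilizer of `v` to `C` along its translate `t • v`,
and pulling the edges in the orbit of `vx` along: the edge from `v` to `x` is replaced by one
from `v` to `t • x`. -/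
structure IsPull (X Y : GTree G) (v x : X.V) (t : G) (C : Subgroup G) (ψ : X.V → Y.V) : Prop where
  deformation : Deformation X Y
  surjective : Function.Surjective ψ
  map_smul : ∀ (g : G) (y : X.V), ψ (g • y) = g • ψ y
  stab_eq : Y.vertexStab (ψ v) = C
  stab_eq_of_notMem : ∀ y, y ∉ MulAction.orbit G v → Y.vertexStab (ψ y) = X.vertexStab y
  notMem : ∀ y, y ∉ MulAction.orbit G v → ψ y ∉ MulAction.orbit G (ψ v)
  adj_translate : Y.graph.Adj (ψ v) (t • ψ v)
  adj_pulled : Y.graph.Adj (ψ v) (t • ψ x)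
  adj_cases : ∀ p q, Y.graph.Adj p q →
    (∃ y z, X.graph.Adj y z ∧ (∀ g : G, ¬ (g • v = y ∧ g • x = z)) ∧
      (∀ g : G, ¬ (g • v = z ∧ g • x = y)) ∧ ψ y = p ∧ ψ z = q) ∨
    ∃ g : G, (g • ψ v = p ∧ g • t • ψ x = q) ∨ (g • ψ v = q ∧ g • t • ψ x = p)

/-- Expand at `t • v`, pulling the edges to `v` and `t • x` onto a new vertex with stabilizer `C`.
As `G_v ≤ C`, the edge from the new vertex to `v` then collapses, and the new vertex takes the place
of `v`. The hypotheses `h1` and `h2` say that `vx` is not in the orbit of the edge from `v` to `t •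
v`, in either orientation. -/
theorem exists_isPull (X : GTree G) {v x : X.V} {t : G} {C : Subgroup G}
    (hT : X.graph.Adj v (t • v)) (hE : X.graph.Adj v x)
    (h1 : ∀ g ∈ X.vertexStab v, x ≠ g • t • v) (h2 : ∀ g : G, g • t • v = v → x ≠ g • v)
    (hvC : X.vertexStab v ≤ C) (hC : C ≤ X.vertexStab (t • v))
    (hEC : X.vertexStab (t • v) ⊓ X.vertexStab (t • x) ≤ C) :
    ∃ (Y : GTree G) (ψ : X.V → Y.V), IsPull X Y v x t C ψ := by
  have hC' : ∀ c ∈ C, c • t • v = t • v := fun c hc => mem_vertexStab.1 (hC hc)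
  let D : X.ExpansionDatum :=
    { a := t • v
      C := C
      N := {z | ∃ c ∈ C, c • v = z ∨ c • t • x = z}
      le_stab := hC
      adj := by
        rintro z ⟨c, hc, rfl | rfl⟩
        · have := X.adj_smul c _ _ hT.symm
          rwa [hC' c hc] at this
        · have := X.adj_smul c _ _ (X.adj_smul t _ _ hE)
          rwa [hC' c hc] at this
      smul_mem := by
        rintro c hc z ⟨c', hc', h⟩
        refine ⟨c * c', C.mul_mem hc hc', ?_⟩
        rcases h with rfl | rfl
        · exact Or.inl (mul_smul _ _ _)
        · exact Or.inr (mul_smul _ _ _)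
      mem_of_smul_mem := by
        rintro g hg z ⟨c, hc, hz⟩ ⟨c', hc', hz'⟩
        have hk : c'⁻¹ * g * c ∈ X.vertexStab (t • v) :=
          mul_mem (mul_mem (inv_mem (hC hc')) hg) (hC hc)
        suffices hk' : c'⁻¹ * g * c ∈ C by
          have := C.mul_mem (C.mul_mem hc' hk') (C.inv_mem hc)
          simpa [mul_assoc] using this
        -- An element taking one of `v`, `t • x` to itself lies in `C` by `hvC` or `hEC`; one
        -- exchanging the two kinds would identify `vx` with the loop edge, against `h2`.
        rcases hz with rfl | rfl <;> rcases hz' with hz' | hz'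
        · exact hvC (mem_vertexStab.2 (by
            rw [mul_smul, mul_smul, ← hz', inv_smul_smul]))
        · refine absurd ?_ (h2 (t⁻¹ * (c'⁻¹ * g * c)) ?_)
          · rw [mul_smul, mul_smul, mul_smul, ← hz', inv_smul_smul, inv_smul_smul]
          · rw [mul_smul, mem_vertexStab.1 hk, inv_smul_smul]
        · refine absurd ?_ (h2 (t⁻¹ * (c'⁻¹ * g * c)⁻¹) ?_)
          · rw [mul_smul, eq_inv_smul_iff, eq_inv_smul_iff, mul_smul, mul_smul, ← hz',
              inv_smul_smul]
          · rw [mul_smul, mem_vertexStab.1 (inv_mem hk), inv_smul_smul]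
        · exact hEC ⟨hk, mem_vertexStab.2 (by
            rw [mul_smul, mul_smul, ← hz', inv_smul_smul])⟩ }
  -- Absorbing the element of `C` into the coset representative.
  have hpull : ∀ {g y z}, D.Pulled g y z → ∃ k, D.new g = D.new k ∧ k • t • v = y ∧
      (k • v = z ∨ k • t • x = z) := by
    rintro g y z ⟨hy, c, hc, hz⟩
    refine ⟨g * c, D.new_eq_new_iff.2 ?_, ?_, ?_⟩
    · rwa [inv_mul_cancel_left]
    · rw [mul_smul, hC' c hc]
      exact hy
    · rwa [mul_smul, mul_smul, ← eq_inv_smul_iff, ← eq_inv_smul_iff (g := g)]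
  -- No edge is pulled at both ends: it would be inverted, or would identify `vx` with the loop
  -- edge, against `h1`.
  have hpull' : ∀ {g k y z}, D.Pulled g y z → ¬ D.Pulled k z y := by
    intro g k y z hg hk
    obtain ⟨g, -, hy, hz⟩ := hpull hg
    obtain ⟨k, -, hz', hy'⟩ := hpull hk
    rcases hz with hz | hz <;> rcases hy' with hy' | hy'
    · refine X.no_inversion (k⁻¹ * g) v (t • v) hT ⟨?_, ?_⟩
      · rw [mul_smul, hz, ← hz', inv_smul_smul]
      · rw [mul_smul, hy, ← hy', inv_smul_smul]
    · refine h1 (t⁻¹ * (k⁻¹ * g)) ?_ ?_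
      · rw [mem_vertexStab, mul_smul, mul_smul, hz, ← hz', inv_smul_smul, inv_smul_smul]
      · rw [mul_smul, mul_smul, hy, ← hy', inv_smul_smul, inv_smul_smul]
    · refine h1 (t⁻¹ * (g⁻¹ * k)) ?_ ?_
      · rw [mem_vertexStab, mul_smul, mul_smul, hy', ← hy, inv_smul_smul, inv_smul_smul]
      · rw [mul_smul, mul_smul, hz', ← hz, inv_smul_smul, inv_smul_smul]
    · refine X.no_inversion (k⁻¹ * g) (t • v) (t • x) (X.adj_smul t _ _ hE) ⟨?_, ?_⟩
      · rw [mul_smul, hy, ← hy', inv_smul_smul]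
      · rw [mul_smul, hz, ← hz', inv_smul_smul]
  have hpv : D.Pulled 1 ((1 : G) • D.a) v :=
    ⟨rfl, 1, C.one_mem, Or.inl (by rw [inv_one])⟩
  have hpx : D.Pulled 1 ((1 : G) • D.a) (t • x) :=
    ⟨rfl, 1, C.one_mem, Or.inr (by rw [inv_one])⟩
  have hT1 : ∀ g k : G, ¬ (k • v = g • v ∧ k • x = g • t • v) := by
    rintro g k ⟨hk1, hk2⟩
    refine h1 (k⁻¹ * g) ?_ ?_
    · rw [mem_vertexStab, mul_smul, ← hk1, inv_smul_smul]
    · rw [mul_smul, ← hk2, inv_smul_smul]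
  have hT2 : ∀ g k : G, ¬ (k • x = g • v ∧ k • v = g • t • v) := by
    rintro g k ⟨hk1, hk2⟩
    refine h2 (k⁻¹ * g) ?_ ?_
    · rw [mul_smul, ← hk2, inv_smul_smul]
    · rw [mul_smul, ← hk1, inv_smul_smul]
  let E : D.expanded.CollapseDatum :=
    { a := D.new 1
      b := D.old v
      adj := D.adj_new_of_pulled hpv fun k => hpull' hpv
      notMem := by
        rintro ⟨g, h⟩
        exact D.old_ne_new _ _ h.symm
      stab_le := by
        rw [D.vertexStab_old, D.vertexStab_new_one]
        exact hvC }
  have hnew : ∀ g, E.proj (D.new g) = g • E.proj (D.old v) := by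
    intro g
    have h := E.proj_a_eq_proj_b g
    rw [E.proj_smul g E.b] at h
    rw [← h]
    change _ = E.proj (D.new (g * 1))
    rw [mul_one]
  have hval : (E.proj (D.old v)).1 = D.new 1 := by
    have h := E.val_proj_b 1
    rwa [one_smul, one_smul] at h
  have hold : ∀ y, y ∉ MulAction.orbit G v → (E.proj (D.old y)).1 = D.old y := by
    intro y hy
    refine E.val_proj ?_
    rintro ⟨g, hg⟩
    exact hy ⟨g, D.old_injective hg⟩
  refine ⟨E.quotient, fun y => E.proj (D.old y), ?_⟩
  refine ⟨D.expansionMove.deformation.trans E.collapseMove.deformation, ?_,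
    fun g y => E.proj_smul g (D.old y), ?_, ?_, ?_, ?_, ?_, ?_⟩
  · intro p
    obtain ⟨P, rfl⟩ := E.proj_surjective p
    rcases D.exists_old_or_new P with ⟨y, rfl⟩ | ⟨g, rfl⟩
    · exact ⟨y, rfl⟩
    · exact ⟨g • v, by rw [hnew, ← E.proj_smul]; rfl⟩
  · exact (E.vertexStab_quotient _).trans (by rw [hval, D.vertexStab_new_one])
  · intro y hy
    exact (E.vertexStab_quotient _).trans (by rw [hold y hy, D.vertexStab_old])
  · rintro y hy ⟨g, hg⟩
    have h : g • (E.proj (D.old v)).1 = (E.proj (D.old y)).1 := congrArg Subtype.val hg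
    rw [hval, hold y hy] at h
    exact D.old_ne_new _ _ h.symm
  · have hadj : D.expanded.graph.Adj (D.new 1) (D.old (t • v)) := by
      have := D.adj_new_old 1
      rwa [one_smul] at this
    refine ⟨fun h => ?_, _, _, hadj, by rw [hnew, one_smul], E.proj_smul t (D.old v)⟩
    have h' : (E.proj (D.old v)).1 = t • (E.proj (D.old v)).1 := congrArg Subtype.val h
    rw [hval, D.smul_new, D.new_eq_new_iff, inv_one, one_mul, mul_one] at h'
    have h3 := hC' t h'
    rw [smul_left_cancel_iff] at h3
    exact hT.ne h3.symm
  · have hadj : D.expanded.graph.Adj (D.new 1) (D.old (t • x)) :=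
      D.adj_new_of_pulled hpx fun k => hpull' hpx
    refine ⟨fun h => ?_, _, _, hadj, by rw [hnew, one_smul], E.proj_smul t (D.old x)⟩
    have h' : (E.proj (D.old v)).1 = t • (E.proj (D.old x)).1 := congrArg Subtype.val h
    by_cases hx : x ∈ MulAction.orbit G v
    · obtain ⟨s, rfl⟩ := hx
      have h3 : E.proj (D.old (s • v)) = s • E.proj (D.old v) := E.proj_smul s (D.old v)
      rw [h3, E.val_smul, hval, D.smul_new, D.smul_new, D.new_eq_new_iff, inv_one, one_mul,
        mul_one] at h'
      have h4 := hC' _ h'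
      rw [mul_smul, smul_left_cancel_iff] at h4
      refine h2 s h4 rfl
    · rw [hval, hold x hx] at h'
      exact D.old_ne_new _ _ h'.symm
  · rintro p q ⟨hne, P, Q, hPQ, rfl, rfl⟩
    have hside : ∀ {y z P Q}, D.Att P y z → D.Att Q z y → E.proj P ≠ E.proj Q →
        (P = D.old y ∧ ∀ g, ¬ D.Pulled g y z) ∨
        ∃ g : G, g • E.proj (D.old v) = E.proj P ∧ g • t • E.proj (D.old x) = E.proj Q := by
      rintro y z P Q (hP | ⟨g, rfl, hg⟩) hQ hne
      · exact Or.inl hP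
      · right
        have hQ : Q = D.old z := by
          rcases hQ with ⟨h, -⟩ | ⟨k, -, hk⟩
          · exact h
          · exact absurd hk (hpull' hg)
        subst hQ
        obtain ⟨k, hgk, -, hz⟩ := hpull hg
        change E.proj (D.new g) ≠ _ at hne
        change ∃ g' : G, _ ∧ _
        refine ⟨k, ?_, ?_⟩
        · change _ = E.proj (D.new g)
          rw [hgk, hnew]
        · rcases hz with rfl | rfl
          · refine absurd ?_ hne
            rw [hgk, hnew, ← E.proj_smul]
            rfl
          · rw [← E.proj_smul, ← E.proj_smul]
            rfl
    rcases D.adj_cases hPQ with ⟨y, z, hyz, hP, hQ⟩ | ⟨g, rfl, rfl⟩ | ⟨g, rfl, rfl⟩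
    · rcases hside hP hQ hne with ⟨rfl, hP'⟩ | ⟨g, h⟩
      · rcases hside hQ hP hne.symm with ⟨rfl, hQ'⟩ | ⟨g, h⟩
        · refine Or.inl ⟨y, z, hyz, ?_, ?_, rfl, rfl⟩
          · rintro g ⟨rfl, rfl⟩
            refine hP' (g * t⁻¹) ⟨?_, 1, C.one_mem, Or.inr ?_⟩
            · change (g * t⁻¹) • t • v = _
              rw [mul_smul, inv_smul_smul]
            · rw [one_smul, mul_inv_rev, inv_inv, mul_smul, inv_smul_smul]
          · rintro g ⟨rfl, rfl⟩
            refine hQ' (g * t⁻¹) ⟨?_, 1, C.one_mem, Or.inr ?_⟩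
            · change (g * t⁻¹) • t • v = _
              rw [mul_smul, inv_smul_smul]
            · rw [one_smul, mul_inv_rev, inv_inv, mul_smul, inv_smul_smul]
        · exact Or.inr ⟨g, Or.inr h⟩
      · exact Or.inr ⟨g, Or.inl h⟩
    · refine Or.inl ⟨g • t • v, g • v, X.adj_smul g _ _ hT.symm, fun k hk => hT2 g k hk.symm,
        fun k => hT1 g k, rfl, ?_⟩
      rw [hnew, ← E.proj_smul]
      rfl
    · refine Or.inl ⟨g • v, g • t • v, X.adj_smul g _ _ hT, hT1 g, fun k hk => hT2 g k hk.symm,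
        ?_, rfl⟩
      rw [hnew, ← E.proj_smul]
      rfl

variable {X Y : GTree G}

/-! ### Stabilizers in generalized Baumslag–Solitar trees -/

theorem isCyclic_of_subgroup_le {H K : Subgroup G} (h : H ≤ K) (hK : IsCyclic K) : IsCyclic H :=
  isCyclic_of_injective (Subgroup.inclusion h) (Subgroup.inclusion_injective h)

theorem infinite_of_subgroup_le {H K : Subgroup G} (h : H ≤ K) (hH : Infinite H) : Infinite K :=
  Infinite.of_injective _ (Subgroup.inclusion_injective h)

theorem edgeStab_smul_infinite {v w : X.V} (h : Infinite (X.edgeStab v w)) (g : G) :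
    Infinite (X.edgeStab (g • v) (g • w)) := by
  have hk : ∀ k : G, g⁻¹ * (g * k * g⁻¹) * g = k := fun k => by group
  refine Infinite.of_injective (fun k : X.edgeStab v w => (⟨g * k.1 * g⁻¹, ?_, ?_⟩ :
    X.edgeStab (g • v) (g • w))) ?_
  · exact mem_vertexStab_smul.2 (by rw [hk]; exact k.2.1)
  · exact mem_vertexStab_smul.2 (by rw [hk]; exact k.2.2)
  · intro a b hab
    exact Subtype.ext (mul_left_cancel (mul_right_cancel (congrArg Subtype.val hab)))

theorem vertexStab_smul_isCyclic {v : X.V} (h : IsCyclic (X.vertexStab v)) (g : G) :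
    IsCyclic (X.vertexStab (g • v)) :=
  (MulAction.stabilizerEquivStabilizer (g := g) (a := v) (b := g • v) rfl).isCyclic.1 h

theorem IsGBS.of_infinite (h1 : ∀ v : X.V, IsCyclic (X.vertexStab v))
    (h2 : ∀ v w : X.V, X.graph.Adj v w → Infinite (X.edgeStab v w))
    (h3 : ∀ v : X.V, Infinite (X.vertexStab v)) : X.IsGBS :=
  ⟨fun v => ⟨h1 v, h3 v⟩, fun v w h => ⟨isCyclic_of_subgroup_le inf_le_left (h1 v), h2 v w h⟩⟩

theorem IsGBS.mul_comm (hX : X.IsGBS) {v : X.V} {g h : G} (hg : g ∈ X.vertexStab v)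
    (hh : h ∈ X.vertexStab v) : g * h = h * g := by
  have := (hX.1 v).1
  have := (IsCyclic.isMulCommutative (α := X.vertexStab v)).is_comm.comm ⟨g, hg⟩ ⟨h, hh⟩
  exact congrArg Subtype.val this

theorem inv_conj_zpow (s h : G) (m : ℤ) : (s⁻¹ * h * s) ^ m = s⁻¹ * h ^ m * s := by
  simpa using conj_zpow (i := m) (a := s⁻¹) (b := h)

/-- Conjugation by `s⁻¹` maps the cyclic group `G_v` into itself, so it is a power map. -/
theorem IsGBS.exists_exponent (hX : X.IsGBS) {v : X.V} {s : G}
    (h : X.vertexStab v ≤ X.vertexStab (s • v)) :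
    ∃ n : ℤ, ∀ g ∈ X.vertexStab v, s⁻¹ * g * s = g ^ n := by
  obtain ⟨⟨a, ha⟩, hgen⟩ := (hX.1 v).1
  obtain ⟨n, hn⟩ := hgen ⟨s⁻¹ * a * s, mem_vertexStab_smul.1 (h ha)⟩
  have hn' : a ^ n = s⁻¹ * a * s := congrArg Subtype.val hn
  refine ⟨n, fun g hg => ?_⟩
  obtain ⟨m, hm⟩ := hgen ⟨g, hg⟩
  have hm' : a ^ m = g := congrArg Subtype.val hm
  rw [← hm', ← inv_conj_zpow, ← hn', ← zpow_mul, ← zpow_mul, Int.mul_comm]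

/-! ### Orbits of vertices and edges -/

/-- There are at most `N` orbits of vertices. -/
def VertexOrbitsLE (X : GTree G) (N : ℕ) : Prop :=
  ∃ S : Finset X.V, S.card ≤ N ∧ ∀ y, ∃ s ∈ S, ∃ g : G, g • s = y

/-- The edge `yz` is in the orbit of the unoriented edge `e`. -/
def InEdgeOrbit (X : GTree G) (e : X.V × X.V) (y z : X.V) : Prop :=
  ∃ g : G, (g • e.1 = y ∧ g • e.2 = z) ∨ (g • e.1 = z ∧ g • e.2 = y)

/-- There are finitely many orbits of edges. -/
def FinitelyManyEdges (X : GTree G) : Prop :=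
  ∃ S : Finset (X.V × X.V), ∀ y z, X.graph.Adj y z → ∃ e ∈ S, X.InEdgeOrbit e y z

theorem InEdgeOrbit.trans {e : X.V × X.V} {v x y z : X.V} (h : X.InEdgeOrbit e v x)
    (h' : X.InEdgeOrbit e y z) : X.InEdgeOrbit (v, x) y z := by
  obtain ⟨g, h⟩ := h
  obtain ⟨k, h'⟩ := h'
  refine ⟨k * g⁻¹, ?_⟩
  rcases h with ⟨rfl, rfl⟩ | ⟨rfl, rfl⟩ <;> rcases h' with ⟨rfl, rfl⟩ | ⟨rfl, rfl⟩ <;>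
    simp [mul_smul]

theorem InEdgeOrbit.map {φ : X.V → Y.V} (hφ : ∀ (g : G) (v : X.V), φ (g • v) = g • φ v)
    {e : X.V × X.V} {y z : X.V} (h : X.InEdgeOrbit e y z) :
    Y.InEdgeOrbit (φ e.1, φ e.2) (φ y) (φ z) := by
  obtain ⟨g, ⟨rfl, rfl⟩ | ⟨rfl, rfl⟩⟩ := h
  · exact ⟨g, Or.inl ⟨(hφ _ _).symm, (hφ _ _).symm⟩⟩
  · exact ⟨g, Or.inr ⟨(hφ _ _).symm, (hφ _ _).symm⟩⟩

theorem IsCocompact.vertexOrbitsLE (hX : X.IsCocompact) : ∃ N, X.VertexOrbitsLE N := by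
  classical
  have := X.isTree.connected.nonempty
  choose! f hf using fun (o : Set X.V) (h : ∃ v : X.V, o = MulAction.orbit G v) => h
  refine ⟨_, hX.1.toFinset.image f, le_rfl, fun y => ?_⟩
  have ho : ∃ v : X.V, MulAction.orbit G y = MulAction.orbit G v := ⟨y, rfl⟩
  refine ⟨f (MulAction.orbit G y), Finset.mem_image_of_mem _ (hX.1.mem_toFinset.2 ho), ?_⟩
  have : y ∈ MulAction.orbit G (f (MulAction.orbit G y)) := by
    rw [← hf _ ho]
    exact MulAction.mem_orbit_self y
  exact this

theorem IsCocompact.finitelyManyEdges (hX : X.IsCocompact) : X.FinitelyManyEdges := by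
  classical
  have := X.isTree.connected.nonempty
  choose! f f' hf using fun (o : Set (X.V × X.V))
    (h : ∃ v w : X.V, X.graph.Adj v w ∧ o = MulAction.orbit G (v, w)) => h
  refine ⟨hX.2.toFinset.image fun o => (f o, f' o), fun y z h => ?_⟩
  have ho : ∃ v w : X.V, X.graph.Adj v w ∧
    MulAction.orbit G (y, z) = MulAction.orbit G (v, w) := ⟨y, z, h, rfl⟩
  refine ⟨_, Finset.mem_image_of_mem _ (hX.2.mem_toFinset.2 ho), ?_⟩
  have : (y, z) ∈ MulAction.orbit G
      (f (MulAction.orbit G (y, z)), f' (MulAction.orbit G (y, z))) := by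
    rw [← (hf _ ho).2]
    exact MulAction.mem_orbit_self _
  obtain ⟨g, hg⟩ := this
  exact ⟨g, Or.inl ⟨congrArg Prod.fst hg, congrArg Prod.snd hg⟩⟩

/-! ### Orbit counts under collapses and pulls -/

/-- `X` can be deformed into a generalized Baumslag–Solitar tree with at most `N` orbits of
vertices. -/
def DeformsToVertexOrbitsLE (X : GTree G) (N : ℕ) : Prop :=
  ∃ Y : GTree G, Deformation X Y ∧ Y.IsGBS ∧ Y.VertexOrbitsLE N ∧ Y.FinitelyManyEdges

theorem CollapseDatum.deformsTo (D : X.CollapseDatum) (hX : X.IsGBS) {N : ℕ}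
    (hN : X.VertexOrbitsLE (N + 1)) (hE : X.FinitelyManyEdges) : X.DeformsToVertexOrbitsLE N := by
  classical
  have hmap : ∀ (g : G) (v : X.V), (D.proj (g • v) : D.quotient.V) = g • (D.proj v : D.quotient.V) :=
    D.proj_smul
  have hinf : ∀ v : D.quotient.V, IsCyclic (D.quotient.vertexStab v) ∧
      Infinite (D.quotient.vertexStab v) := by
    intro v
    rw [D.vertexStab_quotient]
    exact hX.1 _
  refine ⟨D.quotient, D.collapseMove.deformation,
    IsGBS.of_infinite (fun v => (hinf v).1) ?_ (fun v => (hinf v).2), ?_, ?_⟩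
  · rintro _ _ ⟨-, y, z, h, rfl, rfl⟩
    exact infinite_of_subgroup_le (inf_le_inf (vertexStab_le_of_equivariant hmap y)
      (vertexStab_le_of_equivariant hmap z)) (hX.2 y z h).2
  · obtain ⟨S, hS, hcov⟩ := hN
    obtain ⟨s₀, hs₀, g₀, hg₀⟩ := hcov D.b
    obtain ⟨s₁, hs₁, g₁, hg₁⟩ := hcov D.a
    have hne : s₁ ≠ s₀ := by
      rintro rfl
      refine D.notMem ⟨g₀ * g₁⁻¹, ?_⟩
      simp only
      rw [← hg₁, ← hg₀, mul_smul, inv_smul_smul]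
    refine ⟨(S.erase s₀).image D.proj, ?_, ?_⟩
    · refine Finset.card_image_le.trans ?_
      rw [Finset.card_erase_of_mem hs₀]
      omega
    · intro p
      obtain ⟨y, rfl⟩ := D.proj_surjective p
      obtain ⟨s, hs, g, rfl⟩ := hcov y
      by_cases h : s = s₀
      · subst h
        -- The orbit of `b` is now represented by `s₁`, the representative of the orbit of `a`.
        refine ⟨_, Finset.mem_image_of_mem _ (Finset.mem_erase.2 ⟨hne, hs₁⟩), g * g₀⁻¹ * g₁, ?_⟩
        change (g * g₀⁻¹ * g₁) • D.proj s₁ = _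
        rw [mul_smul, ← D.proj_smul g₁, hg₁, ← D.proj_smul, D.proj_a_eq_proj_b, ← hg₀, mul_smul,
          inv_smul_smul]
      · exact ⟨_, Finset.mem_image_of_mem _ (Finset.mem_erase.2 ⟨h, hs⟩), g,
          (D.proj_smul g s).symm⟩
  · obtain ⟨S, hS⟩ := hE
    refine ⟨S.image fun e => (D.proj e.1, D.proj e.2), ?_⟩
    rintro _ _ ⟨-, y, z, h, rfl, rfl⟩
    obtain ⟨e, he, h'⟩ := hS y z h
    exact ⟨_, Finset.mem_image_of_mem _ he, h'.map hmap⟩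

namespace IsPull

variable {v x : X.V} {t : G} {C : Subgroup G} {ψ : X.V → Y.V}

theorem vertexStab_le (hp : IsPull X Y v x t C ψ) (y : X.V) :
    X.vertexStab y ≤ Y.vertexStab (ψ y) := vertexStab_le_of_equivariant hp.map_smul y

theorem isGBS (hp : IsPull X Y v x t C ψ) (hX : X.IsGBS) (hE : X.graph.Adj v x)
    (hC : C ≤ X.vertexStab (t • v)) (hEC : X.vertexStab (t • v) ⊓ X.vertexStab (t • x) ≤ C) :
    Y.IsGBS := by
  refine IsGBS.of_infinite ?_ ?_ ?_
  · intro p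
    obtain ⟨y, rfl⟩ := hp.surjective p
    by_cases hy : y ∈ MulAction.orbit G v
    · obtain ⟨g, rfl⟩ := hy
      simp only
      rw [hp.map_smul]
      refine vertexStab_smul_isCyclic ?_ g
      rw [hp.stab_eq]
      exact isCyclic_of_subgroup_le hC (hX.1 _).1
    · rw [hp.stab_eq_of_notMem y hy]
      exact (hX.1 y).1
  · intro p q hpq
    have he : Infinite (Y.edgeStab (ψ v) (t • ψ x)) := by
      refine infinite_of_subgroup_le (le_inf ?_ ?_) (hX.2 _ _ (X.adj_smul t _ _ hE)).2
      · rw [hp.stab_eq]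
        exact hEC
      · rw [← hp.map_smul]
        exact inf_le_right.trans (hp.vertexStab_le _)
    rcases hp.adj_cases p q hpq with ⟨y, z, h, -, -, rfl, rfl⟩ | ⟨g, ⟨rfl, rfl⟩ | ⟨rfl, rfl⟩⟩
    · exact infinite_of_subgroup_le (inf_le_inf (hp.vertexStab_le y) (hp.vertexStab_le z))
        (hX.2 y z h).2
    · exact edgeStab_smul_infinite he g
    · rw [edgeStab, inf_comm]
      exact edgeStab_smul_infinite he g
  · intro p
    obtain ⟨y, rfl⟩ := hp.surjective p
    exact infinite_of_subgroup_le (hp.vertexStab_le y) (hX.1 y).2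

theorem vertexOrbitsLE (hp : IsPull X Y v x t C ψ) {N : ℕ} (hN : X.VertexOrbitsLE N) :
    Y.VertexOrbitsLE N := by
  classical
  obtain ⟨S, hS, hcov⟩ := hN
  refine ⟨S.image ψ, Finset.card_image_le.trans hS, fun p => ?_⟩
  obtain ⟨y, rfl⟩ := hp.surjective p
  obtain ⟨s, hs, g, rfl⟩ := hcov y
  exact ⟨_, Finset.mem_image_of_mem _ hs, g, (hp.map_smul g s).symm⟩

theorem inEdgeOrbit_or (hp : IsPull X Y v x t C ψ) {p q : Y.V} (h : Y.graph.Adj p q) :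
    Y.InEdgeOrbit (ψ v, t • ψ x) p q ∨
      ∃ y z, X.graph.Adj y z ∧ ¬ X.InEdgeOrbit (v, x) y z ∧ ψ y = p ∧ ψ z = q := by
  rcases hp.adj_cases p q h with ⟨y, z, h, h1, h2, h3⟩ | h
  · refine Or.inr ⟨y, z, h, ?_, h3⟩
    rintro ⟨g, h | h⟩
    · exact h1 g h
    · exact h2 g h
  · exact Or.inl h

theorem finitelyManyEdges (hp : IsPull X Y v x t C ψ) (hE : X.FinitelyManyEdges) :
    Y.FinitelyManyEdges := by
  classical
  obtain ⟨S, hS⟩ := hE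
  refine ⟨insert (ψ v, t • ψ x) (S.image fun e => (ψ e.1, ψ e.2)), fun p q h => ?_⟩
  rcases hp.inEdgeOrbit_or h with h | ⟨y, z, hyz, -, rfl, rfl⟩
  · exact ⟨_, Finset.mem_insert_self _ _, h⟩
  · obtain ⟨e, he, h'⟩ := hS y z hyz
    exact ⟨_, Finset.mem_insert_of_mem (Finset.mem_image_of_mem _ he), h'.map hp.map_smul⟩

end IsPull

/-! ### Reached vertices and free loops -/

/-- A path issuing from `v` starts with an edge that is fixed by everything that fixes its ends. -/
theorem smul_eq_of_isPath {v x w : X.V} {h : X.graph.Adj v x} {p : X.graph.Walk x w}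
    (hp : (SimpleGraph.Walk.cons h p).IsPath) {g : G} (hv : g • v = v) (hw : g • w = w) :
    g • x = x := by
  let f : X.graph →g X.graph := ⟨fun y => g • y, X.adj_smul g _ _⟩
  have hf : Function.Injective f := MulAction.injective g
  have hq : (((SimpleGraph.Walk.cons h p).map f).copy hv hw).IsPath := by
    rw [SimpleGraph.Walk.isPath_copy]
    exact hp.map hf
  have := (X.isTree.isAcyclic.subsingleton_path v w).elim ⟨_, hq⟩ ⟨_, hp⟩
  have h1 := congrArg (fun q : X.graph.Path v w => q.1.getVert 1) this
  simpa [f] using h1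

/-- Some subgroup of the stabilizer of `v` whose index is a power of `n` fixes `y`. -/
def Reaches (X : GTree G) (v : X.V) (n : ℤ) (y : X.V) : Prop :=
  ∃ k : ℕ, ∀ h ∈ X.vertexStab v, h ^ (n ^ k) ∈ X.vertexStab y

theorem reaches_self (v : X.V) (n : ℤ) : X.Reaches v n v :=
  ⟨0, fun _ h => Subgroup.zpow_mem _ h _⟩

theorem Reaches.mono {v y : X.V} {n m : ℤ} (h : X.Reaches v n y) (hnm : n ∣ m) :
    X.Reaches v m y := by
  obtain ⟨k, hk⟩ := h
  obtain ⟨c, hc⟩ := pow_dvd_pow_of_dvd hnm k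
  refine ⟨k, fun g hg => ?_⟩
  rw [hc, zpow_mul]
  exact Subgroup.zpow_mem _ (hk g hg) _

/-- If `h ^ (n ^ j)` fixes `s • v`, its conjugate by `s⁻¹` is in `G_v`, and a further power `n ^ k`
fixes `y`; the exponents add. -/
theorem Reaches.smul {v y : X.V} {n : ℤ} {s : G} (hs : X.Reaches v n (s • v))
    (hy : X.Reaches v n y) : X.Reaches v n (s • y) := by
  obtain ⟨j, hj⟩ := hs
  obtain ⟨k, hk⟩ := hy
  refine ⟨j + k, fun h hh => ?_⟩
  rw [mem_vertexStab_smul, pow_add, zpow_mul]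
  have h1 := hk _ (mem_vertexStab_smul.1 (hj h hh))
  rwa [inv_conj_zpow] at h1

theorem Reaches.fst_of_isPath {v x w : X.V} {n : ℤ} {h : X.graph.Adj v x}
    {p : X.graph.Walk x w} (hp : (SimpleGraph.Walk.cons h p).IsPath) (hw : X.Reaches v n w) :
    X.Reaches v n x := by
  obtain ⟨k, hk⟩ := hw
  exact ⟨k, fun g hg => mem_vertexStab.2 (smul_eq_of_isPath hp
    (mem_vertexStab.1 (Subgroup.zpow_mem _ hg _)) (mem_vertexStab.1 (hk g hg)))⟩

/-- The edge `yz` is a loop at the orbit of `v` in the quotient graph of groups, both labels of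
which divide a power of `n`. -/
def IsFree (X : GTree G) (v : X.V) (n : ℤ) (y z : X.V) : Prop :=
  ∃ g s : G, g • v = y ∧ g • s • v = z ∧ X.Reaches v n (s • v) ∧ X.Reaches v n (s⁻¹ • v)

theorem IsFree.symm {v y z : X.V} {n : ℤ} (h : X.IsFree v n y z) : X.IsFree v n z y := by
  obtain ⟨g, s, rfl, rfl, h1, h2⟩ := h
  exact ⟨g * s, s⁻¹, mul_smul _ _ _, by rw [mul_smul, smul_inv_smul], h2, by rwa [inv_inv]⟩

theorem IsFree.smul {v y z : X.V} {n : ℤ} (h : X.IsFree v n y z) (k : G) :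
    X.IsFree v n (k • y) (k • z) := by
  obtain ⟨g, s, rfl, rfl, h⟩ := h
  exact ⟨k * g, s, mul_smul _ _ _, mul_smul _ _ _, h⟩

theorem IsFree.mono {v y z : X.V} {n m : ℤ} (h : X.IsFree v n y z) (hnm : n ∣ m) :
    X.IsFree v m y z := by
  obtain ⟨g, s, h1, h2, h3, h4⟩ := h
  exact ⟨g, s, h1, h2, h3.mono hnm, h4.mono hnm⟩

theorem IsFree.of_inEdgeOrbit {v : X.V} {n : ℤ} {e : X.V × X.V} {y z : X.V}
    (he : X.IsFree v n e.1 e.2) (h : X.InEdgeOrbit e y z) : X.IsFree v n y z := by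
  obtain ⟨g, ⟨rfl, rfl⟩ | ⟨rfl, rfl⟩⟩ := h
  · exact he.smul g
  · exact (he.smul g).symm

theorem IsFree.exists_eq_smul {v x : X.V} {n : ℤ} (h : X.IsFree v n v x) :
    ∃ s : G, s • v = x ∧ X.Reaches v n (s • v) ∧ X.Reaches v n (s⁻¹ • v) := by
  obtain ⟨g, s, h1, rfl, h2, h3⟩ := h
  refine ⟨g * s, mul_smul _ _ _, ?_, ?_⟩
  · rw [mul_smul]
    exact Reaches.smul (by rw [h1]; exact reaches_self v n) h2
  · rwa [mul_inv_rev, mul_smul, inv_smul_eq_iff.2 h1.symm]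

/-- If some vertex outside of the orbit of `v` is reached, then so is the end of an edge at `v`
that is not free. -/
theorem exists_adj_not_isFree {v w : X.V} {n : ℤ} (hw : w ∉ MulAction.orbit G v)
    (h : X.Reaches v n w) : ∃ x, X.graph.Adj v x ∧ ¬ X.IsFree v n v x ∧ X.Reaches v n x := by
  obtain ⟨p, hp, -⟩ := X.isTree.existsUnique_path v w
  induction hl : p.length generalizing w with
  | zero =>
    obtain rfl := SimpleGraph.Walk.eq_of_length_eq_zero hl
    exact absurd (MulAction.mem_orbit_self v) hw
  | succ l ih =>
    cases p with
    | nil => cases hl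
    | @cons _ x _ hvx q =>
      have hx := h.fst_of_isPath hp
      by_cases hfree : X.IsFree v n v x
      · obtain ⟨s, rfl, h1, h2⟩ := hfree.exists_eq_smul
        let f : X.graph →g X.graph := ⟨fun y => s⁻¹ • y, X.adj_smul s⁻¹ _ _⟩
        have hf : Function.Injective f := MulAction.injective s⁻¹
        -- A free first edge is peeled off by translating the rest of the path back to `v`; the
        -- second label of the loop keeps the endpoint reached.
        refine ih (w := s⁻¹ • w) ?_ (h2.smul h) ((q.map f).copy (inv_smul_smul s v) rfl) ?_ ?_
        · rintro ⟨g, hg⟩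
          refine hw ⟨s * g, ?_⟩
          simp only at hg ⊢
          rw [mul_smul, hg, smul_inv_smul]
        · rw [SimpleGraph.Walk.isPath_copy]
          exact hp.of_cons.map hf
        · simpa using hl
      · exact ⟨x, hvx, hfree, hx⟩

/-- Apply the relation to `t⁻¹ * h * t`, which lies in `G_v`, and cancel a conjugation by `t`. The
ascending relation thus survives enlarging `G_v` to any `C ≤ G_{t • v}`. -/
theorem zpow_mem_of_mem_translate {v : X.V} {t h : G} {n : ℤ}
    (hn : ∀ h ∈ X.vertexStab v, t⁻¹ * h * t = h ^ n) (hh : h ∈ X.vertexStab (t • v)) :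
    t⁻¹ * h * t = h ^ n ∧ h ^ n ∈ X.vertexStab v := by
  have h1 := mem_vertexStab_smul.1 hh
  have h2 := hn _ h1
  rw [inv_conj_zpow] at h2
  have h4 : t⁻¹ * h * t = h ^ n := mul_left_cancel (mul_right_cancel h2)
  exact ⟨h4, h4 ▸ h1⟩

/-! ### Ascending loops and pulls -/

/-- A generalized Baumslag–Solitar tree with an edge from `v` to `t • v` that becomes an ascending
loop of modulus `n`, and a vertex in another orbit that is reached from `v`. -/
structure IsAscending (X : GTree G) (v : X.V) (t : G) (n : ℤ) (N : ℕ) : Prop where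
  isGBS : X.IsGBS
  vertexOrbitsLE : X.VertexOrbitsLE (N + 1)
  finitelyManyEdges : X.FinitelyManyEdges
  adj : X.graph.Adj v (t • v)
  conj_eq : ∀ h ∈ X.vertexStab v, t⁻¹ * h * t = h ^ n
  exists_reaches : ∃ w, w ∉ MulAction.orbit G v ∧ X.Reaches v n w

namespace IsAscending

variable {v : X.V} {t : G} {n : ℤ} {N : ℕ}

theorem vertexStab_le (hX : X.IsAscending v t n N) : X.vertexStab v ≤ X.vertexStab (t • v) := by
  intro h hh
  rw [mem_vertexStab_smul, hX.conj_eq h hh]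
  exact Subgroup.zpow_mem _ hh _

theorem isFree (hX : X.IsAscending v t n N) : X.IsFree v n v (t • v) := by
  refine ⟨1, t, one_smul _ _, one_smul _ _, ⟨0, fun h hh => ?_⟩, ⟨1, fun h hh => ?_⟩⟩
  · exact hX.vertexStab_le (Subgroup.zpow_mem _ hh _)
  · rw [mem_vertexStab_smul, pow_one, ← hX.conj_eq h hh]
    have : t⁻¹⁻¹ * (t⁻¹ * h * t) * t⁻¹ = h := by group
    rwa [this]

theorem exists_isPull (hX : X.IsAscending v t n N) {x : X.V} (hE : X.graph.Adj v x)
    (hx : ¬ X.IsFree v n v x) {C : Subgroup G} (hvC : X.vertexStab v ≤ C)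
    (hC : C ≤ X.vertexStab (t • v)) (hEC : X.vertexStab (t • v) ⊓ X.vertexStab (t • x) ≤ C) :
    ∃ (Y : GTree G) (ψ : X.V → Y.V), IsPull X Y v x t C ψ := by
  refine GTree.exists_isPull X hX.adj hE ?_ ?_ hvC hC hEC
  · rintro g hg rfl
    have := hX.isFree.smul g
    rw [mem_vertexStab.1 hg] at this
    exact hx this
  · rintro g hg rfl
    have := (hX.isFree.smul g).symm
    rw [hg] at this
    exact hx this

variable {x : X.V} {C : Subgroup G} {ψ : X.V → Y.V}

/-- The enlarged stabilizer `C` has its `n`-th powers in `G_v`, at the cost of one more factor `n`.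
-/
theorem reaches_pull (hX : X.IsAscending v t n N) (hp : IsPull X Y v x t C ψ)
    (hC : C ≤ X.vertexStab (t • v)) {y : X.V} (hy : X.Reaches v n y) :
    Y.Reaches (ψ v) n (ψ y) := by
  obtain ⟨k, hk⟩ := hy
  refine ⟨k + 1, fun h hh => ?_⟩
  rw [hp.stab_eq] at hh
  rw [pow_succ', zpow_mul]
  exact hp.vertexStab_le y (hk _ (zpow_mem_of_mem_translate hX.conj_eq (hC hh)).2)

theorem isFree_pull (hX : X.IsAscending v t n N) (hp : IsPull X Y v x t C ψ)
    (hC : C ≤ X.vertexStab (t • v)) {y z : X.V} (h : X.IsFree v n y z) :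
    Y.IsFree (ψ v) n (ψ y) (ψ z) := by
  obtain ⟨g, s, rfl, rfl, h1, h2⟩ := h
  have h1 := hX.reaches_pull hp hC h1
  have h2 := hX.reaches_pull hp hC h2
  rw [hp.map_smul] at h1 h2
  exact ⟨g, s, (hp.map_smul _ _).symm, by rw [hp.map_smul, hp.map_smul], h1, h2⟩

/-- If the pulled edge were free, `x` would be some `s • v`, with witness `s' = t * s * c` for some
`c` in `C`. As `G_{t • v}` is abelian, `c` commutes with powers of `h`, so the bound on the reverse
label for `s'` yields one for `s`; the other label is `hr`. -/
theorem not_isFree_pull (hX : X.IsAscending v t n N) (hp : IsPull X Y v x t C ψ)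
    (hvC : X.vertexStab v ≤ C) (hC : C ≤ X.vertexStab (t • v)) (hr : X.Reaches v n x)
    (hx : ¬ X.IsFree v n v x) : ¬ Y.IsFree (ψ v) n (ψ v) (t • ψ x) := by
  intro hfree
  obtain ⟨s', hs', -, k, hk⟩ := hfree.exists_eq_smul
  have hxv : x ∈ MulAction.orbit G v := by
    by_contra hxv
    refine hp.notMem x hxv ⟨t⁻¹ * s', ?_⟩
    simp only
    rw [mul_smul, hs', inv_smul_smul]
  obtain ⟨s, rfl⟩ := hxv
  refine hx ⟨1, s, one_smul _ _, one_smul _ _, hr, k, fun h hh => ?_⟩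
  have hc : (t * s)⁻¹ * s' ∈ C := by
    rw [← hp.stab_eq, mem_vertexStab, mul_smul, hs', inv_smul_eq_iff, mul_smul]
    exact congrArg (t • ·) (hp.map_smul s v)
  obtain ⟨c, hc', rfl⟩ : ∃ c ∈ C, s' = t * s * c := ⟨_, hc, by rw [mul_inv_cancel_left]⟩
  have h1 := hk h (by rw [hp.stab_eq]; exact hvC hh)
  rw [mem_vertexStab_smul, hp.stab_eq] at h1
  have h2 : c * h ^ n ^ k = h ^ n ^ k * c := hX.isGBS.mul_comm (hC hc')
    (hC (hvC (Subgroup.zpow_mem _ hh _)))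
  have h3 : (t * s * c)⁻¹⁻¹ * h ^ n ^ k * (t * s * c)⁻¹ = t * s * h ^ n ^ k * (t * s)⁻¹ := by
    rw [inv_inv, mul_assoc (t * s) c, h2]
    group
  rw [h3] at h1
  have h4 := mem_vertexStab_smul.1 (hC h1)
  rw [mem_vertexStab_smul]
  have h5 : t⁻¹ * (t * s * h ^ n ^ k * (t * s)⁻¹) * t = s⁻¹⁻¹ * h ^ n ^ k * s⁻¹ := by group
  rwa [h5] at h4

theorem pull (hX : X.IsAscending v t n N) (hp : IsPull X Y v x t C ψ) (hE : X.graph.Adj v x)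
    (hC : C ≤ X.vertexStab (t • v)) (hEC : X.vertexStab (t • v) ⊓ X.vertexStab (t • x) ≤ C) :
    Y.IsAscending (ψ v) t n N where
  isGBS := hp.isGBS hX.isGBS hE hC hEC
  vertexOrbitsLE := hp.vertexOrbitsLE hX.vertexOrbitsLE
  finitelyManyEdges := hp.finitelyManyEdges hX.finitelyManyEdges
  adj := hp.adj_translate
  conj_eq h hh := by
    rw [hp.stab_eq] at hh
    exact (zpow_mem_of_mem_translate hX.conj_eq (hC hh)).1
  exists_reaches := by
    obtain ⟨w, hw, h⟩ := hX.exists_reaches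
    exact ⟨ψ w, hp.notMem w hw, hX.reaches_pull hp hC h⟩

end IsAscending

/-! ### Descent on the non-free edges -/

/-- At most `M` orbits of edges are not free. -/
def NonFreeLE (X : GTree G) (v : X.V) (n : ℤ) (M : ℕ) : Prop :=
  ∃ S : Finset (X.V × X.V), S.card ≤ M ∧
    ∀ y z, X.graph.Adj y z → X.IsFree v n y z ∨ ∃ e ∈ S, X.InEdgeOrbit e y z

/-- Apart from the orbit of the edge `vx`, at most `M` orbits of edges are not free. -/
def NonFreeExceptLE (X : GTree G) (v x : X.V) (n : ℤ) (M : ℕ) : Prop :=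
  ∃ S : Finset (X.V × X.V), S.card ≤ M ∧ ∀ y z, X.graph.Adj y z →
    X.IsFree v n y z ∨ X.InEdgeOrbit (v, x) y z ∨ ∃ e ∈ S, X.InEdgeOrbit e y z

theorem NonFreeLE.exists_except {v x : X.V} {n : ℤ} {M : ℕ} (h : X.NonFreeLE v n M)
    (hE : X.graph.Adj v x) (hx : ¬ X.IsFree v n v x) :
    ∃ M', M = M' + 1 ∧ X.NonFreeExceptLE v x n M' := by
  classical
  obtain ⟨S, hS, hcov⟩ := h
  obtain ⟨e, he, hex⟩ := (hcov v x hE).resolve_left hx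
  have hpos := Finset.card_pos.2 ⟨e, he⟩
  refine ⟨M - 1, by omega, S.erase e, by rw [Finset.card_erase_of_mem he]; omega, ?_⟩
  intro y z hyz
  refine (hcov y z hyz).imp_right ?_
  rintro ⟨e', he', h'⟩
  by_cases hee : e' = e
  · subst hee
    exact Or.inl (hex.trans h')
  · exact Or.inr ⟨e', Finset.mem_erase.2 ⟨hee, he'⟩, h'⟩

theorem IsAscending.nonFreeExceptLE_pull {v x : X.V} {t : G} {n : ℤ} {N M : ℕ} {C : Subgroup G}
    {ψ : X.V → Y.V} (hX : X.IsAscending v t n N) (hp : IsPull X Y v x t C ψ)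
    (hC : C ≤ X.vertexStab (t • v)) (h : X.NonFreeExceptLE v x n M) :
    Y.NonFreeExceptLE (ψ v) (t • ψ x) n M := by
  classical
  obtain ⟨S, hS, hcov⟩ := h
  refine ⟨S.image fun e => (ψ e.1, ψ e.2), Finset.card_image_le.trans hS, fun p q hpq => ?_⟩
  rcases hp.inEdgeOrbit_or hpq with h | ⟨y, z, hyz, hne, rfl, rfl⟩
  · exact Or.inr (Or.inl h)
  · rcases hcov y z hyz with h | h | ⟨e, he, h⟩
    · exact Or.inl (hX.isFree_pull hp hC h)
    · exact absurd h hne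
    · exact Or.inr (Or.inr ⟨_, Finset.mem_image_of_mem _ he, h.map hp.map_smul⟩)

theorem DeformsToVertexOrbitsLE.of_deformation {N : ℕ} (h : Deformation X Y)
    (hY : Y.DeformsToVertexOrbitsLE N) : X.DeformsToVertexOrbitsLE N := by
  obtain ⟨Z, h1, h2⟩ := hY
  exact ⟨Z, h.trans h1, h2⟩

/-- The elements of the stabilizer of `w` whose `m`-th power fixes `y`. -/
def powStab (hX : X.IsGBS) (w y : X.V) (m : ℤ) : Subgroup G where
  carrier := {h | h ∈ X.vertexStab w ∧ h ^ m ∈ X.vertexStab y}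
  one_mem' := ⟨one_mem _, by rw [one_zpow]; exact one_mem _⟩
  mul_mem' := by
    rintro a b ⟨ha, ha'⟩ ⟨hb, hb'⟩
    refine ⟨mul_mem ha hb, ?_⟩
    rw [Commute.mul_zpow (hX.mul_comm ha hb)]
    exact mul_mem ha' hb'
  inv_mem' := by
    rintro a ⟨ha, ha'⟩
    exact ⟨inv_mem ha, by rw [inv_zpow]; exact inv_mem ha'⟩

/-- If the end of an edge that is not free is reached, the number of orbits of vertices or the
number of orbits of edges that are not free can be reduced by a deformation. -/
theorem IsAscending.deformsTo_of_reaches {N M : ℕ}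
    (IH : ∀ (X : GTree G) (v : X.V) (t : G) (n : ℤ), X.IsAscending v t n N →
      X.NonFreeLE v n M → X.DeformsToVertexOrbitsLE N) (k : ℕ) :
    ∀ (X : GTree G) (v x : X.V) (t : G) (n : ℤ), X.IsAscending v t n N → X.graph.Adj v x →
      ¬ X.IsFree v n v x → (∀ h ∈ X.vertexStab v, h ^ (n ^ k) ∈ X.vertexStab x) →
      X.NonFreeExceptLE v x n M → X.DeformsToVertexOrbitsLE N := by
  induction k with
  | zero =>
    intro X v x t n hX hE hx hr hM
    have hle : X.vertexStab v ≤ X.vertexStab x := fun h hh => by simpa using hr h hh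
    by_cases hxv : x ∈ MulAction.orbit G v
    · obtain ⟨s, rfl⟩ := hxv
      simp only at hE hx hr hM hle
      obtain ⟨m, hm⟩ := hX.isGBS.exists_exponent hle
      -- `G_v` fixes `s • v`, so `G_{t • v}` fixes the edge being pulled, and `C` has to be all of
      -- `G_{t • v}`.
      obtain ⟨Y, ψ, hp⟩ := hX.exists_isPull hE hx hX.vertexStab_le le_rfl inf_le_left
      have hY := hX.pull hp hE le_rfl inf_le_left
      have hY' : Y.IsAscending (ψ v) (t * s) (n * m) N :=
        { hY with
          adj := by
            rw [mul_smul, ← hp.map_smul s]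
            exact hp.adj_pulled
          conj_eq := by
            intro h hh
            rw [hp.stab_eq] at hh
            obtain ⟨h1, h2⟩ := zpow_mem_of_mem_translate hX.conj_eq hh
            -- Conjugating by `t⁻¹` gives `h ^ n` in `G_v`, then conjugating by `s⁻¹` raises it to
            -- the power `m`.
            rw [zpow_mul, ← hm _ h2, ← h1]
            group
          exists_reaches := by
            obtain ⟨w, hw, h⟩ := hY.exists_reaches
            exact ⟨w, hw, h.mono (dvd_mul_right n m)⟩ }
      refine .of_deformation hp.deformation (IH Y (ψ v) (t * s) (n * m) hY' ?_)
      obtain ⟨S, hS, hcov⟩ := hX.nonFreeExceptLE_pull hp le_rfl hM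
      refine ⟨S, hS, fun y z hyz => ?_⟩
      rcases hcov y z hyz with h | h | h
      · exact Or.inl (h.mono (dvd_mul_right n m))
      · refine Or.inl (IsFree.of_inEdgeOrbit ?_ h)
        have := hY'.isFree
        rwa [mul_smul, ← hp.map_smul s] at this
      · exact Or.inr h
    · let D : X.CollapseDatum :=
        { a := x
          b := v
          adj := hE.symm
          notMem := fun h => hxv (MulAction.mem_orbit_symm.1 h)
          stab_le := hle }
      exact D.deformsTo hX.isGBS hX.vertexOrbitsLE hX.finitelyManyEdges
  | succ k ih =>
    intro X v x t n hX hE hx hr hM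
    -- The largest choice for which the exponent of the pulled edge drops to `n ^ k`; it contains
    -- `G_v` because moving past `t` absorbs one factor `n`.
    let C := powStab hX.isGBS (t • v) (t • x) (n ^ k)
    have hC : C ≤ X.vertexStab (t • v) := fun h hh => hh.1
    have hvC : X.vertexStab v ≤ C := by
      intro h hh
      refine ⟨hX.vertexStab_le hh, mem_vertexStab_smul.2 ?_⟩
      rw [← inv_conj_zpow, hX.conj_eq h hh, ← zpow_mul, ← pow_succ']
      exact hr h hh
    have hEC : X.vertexStab (t • v) ⊓ X.vertexStab (t • x) ≤ C :=
      fun h hh => ⟨hh.1, Subgroup.zpow_mem _ hh.2 _⟩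
    obtain ⟨Y, ψ, hp⟩ := hX.exists_isPull hE hx hvC hC hEC
    refine .of_deformation hp.deformation (ih Y (ψ v) (t • ψ x) t n (hX.pull hp hE hC hEC)
      hp.adj_pulled (hX.not_isFree_pull hp hvC hC ⟨_, hr⟩ hx) ?_
      (hX.nonFreeExceptLE_pull hp hC hM))
    intro h hh
    rw [hp.stab_eq] at hh
    rw [← hp.map_smul]
    exact hp.vertexStab_le _ hh.2

theorem IsAscending.deformsTo {N : ℕ} (M : ℕ) : ∀ (X : GTree G) (v : X.V) (t : G) (n : ℤ),
    X.IsAscending v t n N → X.NonFreeLE v n M → X.DeformsToVertexOrbitsLE N := by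
  induction M with
  | zero =>
    intro X v t n hX hM
    obtain ⟨w, hw, hr⟩ := hX.exists_reaches
    obtain ⟨x, hE, hx, -⟩ := exists_adj_not_isFree hw hr
    -- A non-free edge exists, so the count cannot be zero.
    obtain ⟨M', h, -⟩ := hM.exists_except hE hx
    cases h
  | succ M ih =>
    intro X v t n hX hM
    obtain ⟨w, hw, hr⟩ := hX.exists_reaches
    obtain ⟨x, hE, hx, k, hk⟩ := exists_adj_not_isFree hw hr
    obtain ⟨M', h, hM'⟩ := hM.exists_except hE hx
    obtain rfl : M = M' := by omega
    exact deformsTo_of_reaches ih k X v x t n hX hE hx hk hM'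

/-! ### Induction on the vertex orbits -/

/-- The number of orbits of vertices of a tree that is not fully reduced can be decreased. -/
theorem deformsTo_of_vertexStab_le (hX : X.IsGBS) {N : ℕ} (hN : X.VertexOrbitsLE (N + 1))
    (hE : X.FinitelyManyEdges) {v w : X.V} (hvw : X.vertexStab v ≤ X.vertexStab w)
    (hw : w ∉ MulAction.orbit G v) : X.DeformsToVertexOrbitsLE N := by
  obtain ⟨p, hp, -⟩ := X.isTree.existsUnique_path v w
  cases p with
  | nil => exact absurd (MulAction.mem_orbit_self v) hw
  | @cons _ x _ hvx q =>
    have hle : X.vertexStab v ≤ X.vertexStab x := fun g hg => mem_vertexStab.2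
      (smul_eq_of_isPath hp (mem_vertexStab.1 hg) (mem_vertexStab.1 (hvw hg)))
    by_cases hxv : x ∈ MulAction.orbit G v
    · obtain ⟨t, rfl⟩ := hxv
      obtain ⟨n, hn⟩ := hX.exists_exponent hle
      obtain ⟨S, hS⟩ := id hE
      -- `G_v` fixes `w`, so `w` is reached with exponent `n ^ 0`. Initially every edge orbit may be
      -- counted as non-free.
      refine IsAscending.deformsTo S.card X v t n ⟨hX, hN, hE, hvx, hn, w, hw, 0, fun h hh =>
        Subgroup.zpow_mem _ (hvw hh) _⟩ ⟨S, le_rfl, fun y z hyz => Or.inr (hS y z hyz)⟩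
    · let D : X.CollapseDatum :=
        { a := x
          b := v
          adj := hvx.symm
          notMem := fun h => hxv (MulAction.mem_orbit_symm.1 h)
          stab_le := hle }
      exact D.deformsTo hX hN hE

theorem exists_isFullyReduced (N : ℕ) : ∀ X : GTree G, X.IsGBS → X.VertexOrbitsLE N →
    X.FinitelyManyEdges → ∃ Y : GTree G, Deformation X Y ∧ Y.IsGBS ∧ Y.IsFullyReduced := by
  induction N with
  | zero =>
    rintro X - ⟨S, hS, hcov⟩ -
    obtain ⟨v⟩ := X.isTree.connected.nonempty
    obtain ⟨s, hs, -⟩ := hcov v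
    have := Finset.card_pos.2 ⟨s, hs⟩
    omega
  | succ N ih =>
    intro X hX hN hE
    by_cases hr : X.IsFullyReduced
    · exact ⟨X, .refl, hX, hr⟩
    · simp only [IsFullyReduced, not_forall] at hr
      obtain ⟨v, w, hvw, hv⟩ := hr
      obtain ⟨Y, h1, h2, h3, h4⟩ := deformsTo_of_vertexStab_le hX hN hE hvw
        fun h => hv (MulAction.mem_orbit_symm.1 h)
      obtain ⟨Z, h5, h6⟩ := ih Y h2 h3 h4
      exact ⟨Z, h1.trans h5, h6⟩

end GTree

theorem mainTheorem1 {G : Type u} [Group G] (X : GTree G)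
    (hX : X.IsGBS) (hc : X.IsCocompact) :
    ∃ Y : GTree G, GTree.Deformation X Y ∧ Y.IsGBS ∧ Y.IsFullyReduced := by
  obtain ⟨N, hN⟩ := hc.vertexOrbitsLE
  exact GTree.exists_isFullyReduced N X hX hN hc.finitelyManyEdges
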